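/- Let $D=(0,1)$, $n\ge 1$, $0<\alpha_1<\dots<\alpha_n\le 2$ with $\alpha_1<2$, and $\omega\in\mathbb R$. Put $s=\sum_{k=1}^n(\mathrm i\omega)^{\alpha_k}$ (principal values), let $\sqrt{\cdot}$ be the principal square root, and for $x,y\in[0,1]$ let $$G_\omega(x,y)=\begin{cases}\max\{x,y\}-1,&\omega=0,\\[1mm] \dfrac{\mathrm e^{\sqrt s(x+y)}+\mathrm e^{\sqrt s|x-y|}-\mathrm e^{\sqrt s(2-x-y)}-\mathrm e^{\sqrt s(2-|x-y|)}}{2\sqrt s\,(1+\mathrm e^{2\sqrt s})},&\omega\ne0,\end{cases}$$ be the Green function of $\partial_{xx}G-sG=\delta(x-y)$, $\partial_xG(0,y)=0$, $G(1,y)=0$. Let $\tilde G_\omega(x,\cdot)$ be the extension of $G_\omega(x,\cdot)$ from $D$ to $\mathbb R$ by zero, and let $\hat{\tilde G}_\omega(x,\zeta)=\int_{\mathbb R}\tilde G_\omega(x,y)\mathrm e^{-\mathrm i\zeta y}\,\mathrm dy$. Let $H\in(0,1)$, let $B^H$ be a fractional Brownian motion on $\mathbb R$ with Hurst index $H$,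 that is, a centered Gaussian process with covariance $\frac12(|x|^{2H}+|y|^{2H}-|x-y|^{2H})$, and let $C_H=\big(H\,\Gamma(2H)\sin(H\pi)/\pi\big)^{1/2}$. Let $\mathscr H^\gamma(\mathbb R)$ be the space of $u\in L^2(\mathbb R)$ with $\int_{\mathbb R}(1+|\zeta|^2)^\gamma|\hat u(\zeta)|^2\,\mathrm d\zeta<\infty$. The integral of a step function $\sum_k c_k1_{(a_k,b_k]}$ with respect to $B^H$ is $\sum_kc_k(B^H(b_k)-B^H(a_k))$, and the integral of $\phi\in C_0^\infty(\mathbb R)$ is the limit in mean square of its Riemann–Stieltjes sums as the mesh tends to $0$. A square integrable random variable $X$ is called the Wiener integral $\int_D G_\omega(x,y)\,\mathrm dB^H(y)$ if $\tilde G_\omega(x,\cdot)$ is a limit of step functions and a limit of functions in $C_0^\infty(\mathbb R)$ (whose integrals exist), and if $X$ is the mean square limit of the integrals of every sequence of such functions that converges to $\tilde G_\omega(x,\cdot)$; here convergence of integrands is meant in $\mathscr H^{\frac12-H}(\mathbb R)$ if $H<\frac12$, in $L^2(\mathbb R)$ if $H=\frac12$, and in $L^1(\mathbb R)\cap L^2(\mathbb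 R)$ if $H>\frac12$. Then for every $x\in\overline D$ the integral $\int_D G_\omega(x,y)\,\mathrm dB^H(y)$ is well defined, i.e. it exists and is unique up to almost sure equality, and $$\mathbb E\left|\int_D G_\omega(x,y)\,\mathrm dB^H(y)\right|^2=C_H^2\int_{\mathbb R}\frac{|\hat{\tilde G}_\omega(x,\zeta)|^2}{|\zeta|^{2H-1}}\,\mathrm d\zeta<\infty .$$ Moreover, $\tilde G_\omega(x,\cdot)\in\mathscr H^{\frac12-H}(\mathbb R)$ if $H<\frac12$, whereas $\tilde G_\omega(x,\cdot)\notin\mathscr H^1(\mathbb R)$ if $x<1$. -/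

import Mathlib

open MeasureTheory ProbabilityTheory Filter Topology
open scoped ENNReal

noncomputable section

namespace FBMSource

/-- Fractional Brownian motion on `ℝ` with Hurst index `H`: a centred Gaussian process with
covariance `(|x|^{2H} + |y|^{2H} - |x - y|^{2H}) / 2`. -/
structure IsFBM {Ω : Type*} [MeasurableSpace Ω] (P : Measure Ω) (H : ℝ) (B : ℝ → Ω → ℝ) :
    Prop where
  gaussian : IsGaussianProcess B P
  centered : ∀ x, ∫ ϖ, B x ϖ ∂P = 0
  covariance : ∀ x y, ∫ ϖ, B x ϖ * B y ϖ ∂P =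
    (|x| ^ (2 * H) + |y| ^ (2 * H) - |x - y| ^ (2 * H)) / 2

/-- The constant `C_H`. -/
def CH (H : ℝ) : ℝ := √(H * Real.Gamma (2 * H) * Real.sin (H * Real.pi) / Real.pi)

/-- `s = ∑ₖ (i ω)^{αₖ}`, principal values. -/
def freqS {n : ℕ} (α : Fin n → ℝ) (ω : ℝ) : ℂ :=
  ∑ k, (Complex.I * (ω : ℂ)) ^ ((α k : ℝ) : ℂ)

/-- The principal square root of a complex number. -/
def csqrt (z : ℂ) : ℂ := z ^ (1 / 2 : ℂ)

/-- The Green function `G_ω(x, y)`. -/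
def green {n : ℕ} (α : Fin n → ℝ) (ω x y : ℝ) : ℂ :=
  if ω = 0 then ((max x y - 1 : ℝ) : ℂ)
  else
    (Complex.exp (csqrt (freqS α ω) * ((x + y : ℝ) : ℂ))
      + Complex.exp (csqrt (freqS α ω) * ((|x - y| : ℝ) : ℂ))
      - Complex.exp (csqrt (freqS α ω) * ((2 - x - y : ℝ) : ℂ))
      - Complex.exp (csqrt (freqS α ω) * ((2 - |x - y| : ℝ) : ℂ)))
    / (2 * csqrt (freqS α ω) * (1 + Complex.exp (2 * csqrt (freqS α ω))))

/-- The extension of `G_ω(x, ·)` by zero outside `D = (0, 1)`. -/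
def greenExt {n : ℕ} (α : Fin n → ℝ) (ω x : ℝ) : ℝ → ℂ :=
  Set.indicator (Set.Ioo 0 1) (green α ω x)

/-- The Fourier transform `∫ f(y) e^{-iζy} dy` of an integrable function. -/
def fourierT (f : ℝ → ℂ) (ζ : ℝ) : ℂ :=
  ∫ y, f y * Complex.exp (-(Complex.I * (ζ : ℂ) * (y : ℂ)))

/-- The square of the norm of `𝓗^γ(ℝ)`, for an integrable function `f`, as an extended real. -/
def sobolevSq (γ : ℝ) (f : ℝ → ℂ) : ℝ≥0∞ :=
  ∫⁻ ζ : ℝ, ENNReal.ofReal ((1 + ζ ^ 2) ^ γ) * ‖fourierT f ζ‖ₑ ^ 2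

/-- Membership in `𝓗^γ(ℝ)`, for an integrable function `f`. -/
def MemH (γ : ℝ) (f : ℝ → ℂ) : Prop := MemLp f 2 volume ∧ sobolevSq γ f < ∞

/-- `Y` is the elementary integral `∑ₖ cₖ (B(bₖ) - B(aₖ))` of the step function
`φ = ∑ₖ cₖ 1_{(aₖ, bₖ]}`. -/
def IsStepIntegral {Ω : Type*} (B : ℝ → Ω → ℝ) (φ : ℝ → ℂ) (Y : Ω → ℂ) : Prop :=
  ∃ (N : ℕ) (a b : Fin N → ℝ) (c : Fin N → ℂ), (∀ k, a k ≤ b k) ∧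
    (φ = fun y ↦ ∑ k, Set.indicator (Set.Ioc (a k) (b k)) (fun _ ↦ c k) y) ∧
    (Y = fun ϖ ↦ ∑ k, c k * ((B (b k) ϖ - B (a k) ϖ : ℝ) : ℂ))

/-- `φ ∈ C₀^∞(ℝ)` and `Y` is the integral of `φ` with respect to `B`: the limit in mean square
of the Riemann–Stieltjes sums over tagged partitions of intervals containing the support, as the
mesh tends to zero. -/
def IsTestIntegral {Ω : Type*} [MeasurableSpace Ω] (P : Measure Ω) (B : ℝ → Ω → ℝ)
    (φ : ℝ → ℂ) (Y : Ω → ℂ) : Prop :=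
  ContDiff ℝ ((⊤ : ℕ∞) : WithTop ℕ∞) φ ∧ HasCompactSupport φ ∧ MemLp Y 2 P ∧
    ∀ ε : ℝ, 0 < ε → ∃ δ : ℝ, 0 < δ ∧ ∀ (N : ℕ) (t τ : ℕ → ℝ), Monotone t →
      Function.support φ ⊆ Set.Icc (t 0) (t N) →
      (∀ k < N, τ k ∈ Set.Icc (t k) (t (k + 1)) ∧ t (k + 1) - t k ≤ δ) →
      eLpNorm (fun ϖ ↦ Y ϖ - ∑ k ∈ Finset.range N,
        φ (τ k) * ((B (t (k + 1)) ϖ - B (t k) ϖ : ℝ) : ℂ)) 2 P ≤ ENNReal.ofReal ε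

/-- Convergence of integrands: in `𝓗^{1/2-H}(ℝ)` if `H < 1/2`, in `L²(ℝ)` if `H = 1/2`, and in
`L¹(ℝ) ∩ L²(ℝ)` if `H > 1/2`. -/
def IntegrandTendsto (H : ℝ) (φ : ℕ → ℝ → ℂ) (f : ℝ → ℂ) : Prop :=
  (H < 1 / 2 → Tendsto (fun n ↦ sobolevSq (1 / 2 - H) (φ n - f)) atTop (𝓝 0)) ∧
  (1 / 2 ≤ H → Tendsto (fun n ↦ eLpNorm (φ n - f) 2 volume) atTop (𝓝 0)) ∧
  (1 / 2 < H → Tendsto (fun n ↦ eLpNorm (φ n - f) 1 volume) atTop (𝓝 0))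

/-- `X` is the Wiener integral `∫ f dB` of the integrand `f` with respect to the fractional
Brownian motion `B` of Hurst index `H`. The integrand is a limit of step functions and a limit of
functions in `C₀^∞(ℝ)`, and `X` is the mean square limit of the integrals of every sequence of
such functions that converges to `f`. -/
structure IsWienerIntegral {Ω : Type*} [MeasurableSpace Ω] (P : Measure Ω) (H : ℝ)
    (B : ℝ → Ω → ℝ) (f : ℝ → ℂ) (X : Ω → ℂ) : Prop where
  memLp : MemLp X 2 P
  exists_step : ∃ (φ : ℕ → ℝ → ℂ) (Y : ℕ → Ω → ℂ),
    (∀ n, IsStepIntegral B (φ n) (Y n)) ∧ IntegrandTendsto H φ f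
  exists_test : ∃ (φ : ℕ → ℝ → ℂ) (Y : ℕ → Ω → ℂ),
    (∀ n, IsTestIntegral P B (φ n) (Y n)) ∧ IntegrandTendsto H φ f
  tendsto : ∀ (φ : ℕ → ℝ → ℂ) (Y : ℕ → Ω → ℂ),
    (∀ n, IsStepIntegral B (φ n) (Y n) ∨ IsTestIntegral P B (φ n) (Y n)) →
    IntegrandTendsto H φ f →
    Tendsto (fun n ↦ eLpNorm (fun ϖ ↦ Y n ϖ - X ϖ) 2 P) atTop (𝓝 0)

end FBMSource

end

open scoped NNReal

noncomputable section

namespace FBMSource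

open Set

/-! The proof rests on a spectral isometry. The constant `CH` is the one for which `|t|^{2H} = 2
C_H² ∫ (1 - cos tζ) |ζ|^{-1-2H} dζ` (`integral_one_sub_cos`). Inserted into the covariance, this
gives `E|∫ φ dB|² = C_H² ∫ |φ̂(ζ)|² |ζ|^{1-2H} dζ` for step functions (`IsFBM.eLpNorm_stepInt`). By
completeness of `L²(P)` the isometry extends to every integrable `φ` approximated by step functions
in the weighted norm on the right (`IsSpectralIntegral`). Test functions belong to this class,
because their Riemann–Stieltjes sums are elementary integrals. Each of the three modes of
convergence dominates the weighted norm (`IntegrandTendsto.tendsto_eLpNorm_fourierT`), so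
independence of the approximating sequence, uniqueness and the second moment all follow from the
isometry.

It remains to approximate the Green function. A bounded function of bounded variation satisfies `|ζ|
|f̂(ζ)| ≤ K`. If a family shares this bound, smallness in `L¹` forces smallness in `L²(μ)` whenever
`(1 + ζ²)⁻¹` is `μ`-integrable (`exists_forall_lintegral_fourierT_le`); this covers both `|ζ|^{1-2H}
dζ` and, for `H < 1/2`, the Sobolev weight. Uniform step interpolation and mollification both
preserve such bounds. As `G_ω(x, ·)` is Lipschitz on `[0, 1]`, the argument applies, and the same
decay gives membership in `𝓗^γ` for `γ < 1/2`.

Membership in `𝓗¹` fails because of the jump at `y = 0`: there `‖f(· + h) - f‖₂²` is at least of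
order `h`, whereas in `𝓗¹` it would be `O(h²)`. The jump is nonzero because `Re √s > 0`. -/

/-! ### The spectral integral of `1 - cos` and the constant `C_H`. -/

lemma lintegral_rpow_mul_exp_neg {a r : ℝ} (ha : 0 < a) (hr : 0 < r) :
    ∫⁻ t in Ioi (0 : ℝ), ENNReal.ofReal (t ^ (a - 1) * Real.exp (-(r * t))) =
      ENNReal.ofReal (r ^ (-a) * Real.Gamma a) := by
  have h := Real.integral_rpow_mul_exp_neg_mul_Ioi ha hr
  have hG := Real.Gamma_pos_of_pos ha
  -- A Bochner integral is `0` for a non-integrable function, so a nonzero value already proves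
  -- integrability. The same device recurs below.
  rw [← ofReal_integral_eq_lintegral_ofReal (.of_integral_ne_zero (by rw [h]; positivity)), h,
    Real.rpow_neg hr.le, one_div, Real.inv_rpow hr.le]
  filter_upwards [ae_restrict_mem measurableSet_Ioi] with t ht
  have : (0 : ℝ) < t := ht
  positivity

lemma lintegral_exp_neg_mul {r : ℝ} (hr : 0 < r) :
    ∫⁻ t in Ioi (0 : ℝ), ENNReal.ofReal (Real.exp (-(r * t))) = ENNReal.ofReal (1 / r) := by
  simpa [Real.rpow_neg_one] using lintegral_rpow_mul_exp_neg one_pos hr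

lemma lintegral_rpow_mul_exp_neg_mul_sq {H r : ℝ} (hH : 0 < H) (hr : 0 < r) :
    ∫⁻ u in Ioi (0 : ℝ), ENNReal.ofReal (u ^ (2 * H - 1) * Real.exp (-(r * u ^ 2))) =
      ENNReal.ofReal (r ^ (-H) * (Real.Gamma H / 2)) := by
  have h := integral_rpow_mul_exp_neg_mul_rpow (p := 2) (q := 2 * H - 1) (b := r) two_pos
    (by linarith) hr
  have hG := Real.Gamma_pos_of_pos hH
  rw [show -(2 * H - 1 + 1) / 2 = -H by ring, show (2 * H - 1 + 1) / 2 = H by ring] at h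
  have h' : ∫ u in Ioi (0 : ℝ), u ^ (2 * H - 1) * Real.exp (-(r * u ^ 2)) =
      r ^ (-H) * (Real.Gamma H / 2) := by
    rw [← mul_div_assoc, div_eq_mul_one_div, mul_right_comm, ← h]
    simp
  rw [← ofReal_integral_eq_lintegral_ofReal (.of_integral_ne_zero (by rw [h']; positivity)), h']
  filter_upwards [ae_restrict_mem measurableSet_Ioi] with t ht
  have : (0 : ℝ) < t := ht
  positivity

/-- Write `1 / (1 + u²) = ∫ e^{-r(1 + u²)} dr` and exchange the integrals by Tonelli: the
`u`-integral yields `r^{-H} Γ(H) / 2` and the remaining `r`-integral is `Γ(1 - H)`. -/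
lemma lintegral_rpow_div_one_add_sq {H : ℝ} (hH0 : 0 < H) (hH1 : H < 1) :
    ∫⁻ u in Ioi (0 : ℝ), ENNReal.ofReal (u ^ (2 * H - 1) * (1 / (1 + u ^ 2))) =
      ENNReal.ofReal (Real.Gamma H * Real.Gamma (1 - H) / 2) := by
  have hG := Real.Gamma_pos_of_pos hH0
  calc _ = ∫⁻ u in Ioi (0 : ℝ), ∫⁻ r in Ioi (0 : ℝ),
        ENNReal.ofReal (u ^ (2 * H - 1) * Real.exp (-(r * u ^ 2)) * Real.exp (-r)) := by
        refine setLIntegral_congr_fun measurableSet_Ioi fun u hu ↦ ?_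
        have hu' : (0 : ℝ) < u := hu
        rw [ENNReal.ofReal_mul (by positivity), ← lintegral_exp_neg_mul (by positivity),
          ← lintegral_const_mul _ (by fun_prop)]
        refine lintegral_congr fun r ↦ ?_
        rw [← ENNReal.ofReal_mul (by positivity), mul_assoc, ← Real.exp_add]
        ring_nf
    _ = ∫⁻ r in Ioi (0 : ℝ), ∫⁻ u in Ioi (0 : ℝ),
        ENNReal.ofReal (u ^ (2 * H - 1) * Real.exp (-(r * u ^ 2)) * Real.exp (-r)) :=
        lintegral_lintegral_swap (by fun_prop)
    _ = ∫⁻ r in Ioi (0 : ℝ), ENNReal.ofReal (Real.Gamma H / 2) *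
          ENNReal.ofReal (r ^ ((1 - H) - 1) * Real.exp (-(1 * r))) := by
        refine setLIntegral_congr_fun measurableSet_Ioi fun r hr ↦ ?_
        have hr' : (0 : ℝ) < r := hr
        simp_rw [ENNReal.ofReal_mul' (Real.exp_pos (-r)).le]
        rw [lintegral_mul_const _ (by fun_prop), lintegral_rpow_mul_exp_neg_mul_sq hH0 hr',
          ← ENNReal.ofReal_mul (by positivity), ← ENNReal.ofReal_mul (by positivity)]
        ring_nf
    _ = _ := by
        rw [lintegral_const_mul _ (by fun_prop),
          lintegral_rpow_mul_exp_neg (by linarith) one_pos, ← ENNReal.ofReal_mul (by positivity)]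
        simp only [Real.one_rpow]
        ring_nf

/-- Laplace transform of `1 - cos`: the real part of `1/u - 1/(u - i)`, that is `1/u - u/(1 + u²)`.
-/
lemma lintegral_one_sub_cos_mul_exp_neg {u : ℝ} (hu : 0 < u) :
    ∫⁻ z in Ioi (0 : ℝ), ENNReal.ofReal ((1 - Real.cos z) * Real.exp (-(z * u))) =
      ENNReal.ofReal (1 / (u * (1 + u ^ 2))) := by
  have hre : ((-u : ℂ) + Complex.I).re < 0 := by simpa using hu
  have hi1 := integrableOn_exp_mul_complex_Ioi hre 0
  have h1 := integral_exp_mul_complex_Ioi hre 0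
  have hre' : ((-u : ℂ)).re < 0 := by simpa using hu
  have hi2 := integrableOn_exp_mul_complex_Ioi hre' 0
  have h2 := integral_exp_mul_complex_Ioi hre' 0
  have key : ∀ z : ℝ, (1 - Real.cos z) * Real.exp (-(z * u)) =
      (Complex.exp ((-u : ℂ) * z) - Complex.exp (((-u : ℂ) + Complex.I) * z)).re := by
    intro z
    simp [Complex.exp_re]
    ring_nf
  have hint : IntegrableOn (fun z : ℝ ↦ (1 - Real.cos z) * Real.exp (-(z * u))) (Ioi 0) := by
    simp_rw [key]
    exact (hi2.sub hi1).re
  rw [← ofReal_integral_eq_lintegral_ofReal hint]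
  · congr 1
    simp_rw [key]
    have := integral_re (hi2.sub hi1)
    simp only [Pi.sub_apply, RCLike.re_to_complex] at this
    rw [this, integral_sub hi2 hi1, h1, h2]
    simp [Complex.inv_re, Complex.div_re, Complex.normSq_apply]
    field_simp
    ring
  · exact ae_of_all _ fun z ↦ mul_nonneg (by linarith [Real.cos_le_one z]) (Real.exp_pos _).le

/-- Since `Γ(1 + 2H) z^{-(1 + 2H)} = ∫ u^{2H} e^{-zu} du`, Tonelli reduces the integral to the
Laplace transform of `1 - cos` followed by `lintegral_rpow_div_one_add_sq`. -/
lemma lintegral_Ioi_one_sub_cos {H : ℝ} (hH0 : 0 < H) (hH1 : H < 1) :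
    ∫⁻ z in Ioi (0 : ℝ), ENNReal.ofReal ((1 - Real.cos z) * z ^ (-(1 + 2 * H))) =
      ENNReal.ofReal (Real.Gamma H * Real.Gamma (1 - H) / 2 / Real.Gamma (1 + 2 * H)) := by
  have hG := Real.Gamma_pos_of_pos (show 0 < 1 + 2 * H by linarith)
  have hcos : ∀ z : ℝ, 0 ≤ 1 - Real.cos z := fun z ↦ by linarith [Real.cos_le_one z]
  have hmul : ENNReal.ofReal (Real.Gamma (1 + 2 * H)) *
      ∫⁻ z in Ioi (0 : ℝ), ENNReal.ofReal ((1 - Real.cos z) * z ^ (-(1 + 2 * H))) =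
      ENNReal.ofReal (Real.Gamma H * Real.Gamma (1 - H) / 2) := by
    rw [← lintegral_const_mul _ (by fun_prop), ← lintegral_rpow_div_one_add_sq hH0 hH1]
    calc _ = ∫⁻ z in Ioi (0 : ℝ), ∫⁻ u in Ioi (0 : ℝ), ENNReal.ofReal (u ^ (2 * H)) *
          ENNReal.ofReal ((1 - Real.cos z) * Real.exp (-(z * u))) := by
          refine setLIntegral_congr_fun measurableSet_Ioi fun z hz ↦ ?_
          have hz' : (0 : ℝ) < z := hz
          rw [mul_comm, ENNReal.ofReal_mul (hcos z), mul_assoc, ← ENNReal.ofReal_mul (by positivity),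
            ← lintegral_rpow_mul_exp_neg (by linarith) hz', ← lintegral_const_mul _ (by fun_prop)]
          refine setLIntegral_congr_fun measurableSet_Ioi fun u hu ↦ ?_
          have hu' : (0 : ℝ) < u := hu
          rw [← ENNReal.ofReal_mul (hcos z), ← ENNReal.ofReal_mul (by positivity)]
          ring_nf
      _ = ∫⁻ u in Ioi (0 : ℝ), ∫⁻ z in Ioi (0 : ℝ), ENNReal.ofReal (u ^ (2 * H)) *
          ENNReal.ofReal ((1 - Real.cos z) * Real.exp (-(z * u))) :=
          lintegral_lintegral_swap (by fun_prop)
      _ = _ := by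
          refine setLIntegral_congr_fun measurableSet_Ioi fun u hu ↦ ?_
          have hu' : (0 : ℝ) < u := hu
          rw [lintegral_const_mul _ (by fun_prop), lintegral_one_sub_cos_mul_exp_neg hu',
            ← ENNReal.ofReal_mul (by positivity)]
          congr 1
          rw [Real.rpow_sub_one hu'.ne']
          field_simp
  rw [ENNReal.ofReal_div_of_pos hG, ← hmul, ENNReal.mul_div_right_comm, ENNReal.div_self, one_mul]
  · simpa using hG
  · simp

lemma CH_nonneg (H : ℝ) : 0 ≤ CH H := Real.sqrt_nonneg _

lemma CH_sq {H : ℝ} (hH0 : 0 < H) (hH1 : H < 1) :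
    CH H ^ 2 = H * Real.Gamma (2 * H) * Real.sin (H * Real.pi) / Real.pi := by
  have h1 := Real.Gamma_pos_of_pos (show 0 < 2 * H by linarith)
  have h2 : 0 < Real.sin (H * Real.pi) := Real.sin_pos_of_pos_of_lt_pi (by positivity)
    (by nlinarith [Real.pi_pos])
  exact Real.sq_sqrt (by positivity)

lemma CH_pos {H : ℝ} (hH0 : 0 < H) (hH1 : H < 1) : 0 < CH H := by
  have h1 := Real.Gamma_pos_of_pos (show 0 < 2 * H by linarith)
  have h2 : 0 < Real.sin (H * Real.pi) := Real.sin_pos_of_pos_of_lt_pi (by positivity)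
    (by nlinarith [Real.pi_pos])
  exact Real.sqrt_pos.2 (by positivity)

/-- The value of `CH` comes from here: Euler's reflection formula turns `Γ(H) Γ(1 - H)` into `π /
sin(πH)`, and `Γ(1 + 2H) = 2H Γ(2H)`. -/
lemma integral_Ioi_one_sub_cos {H : ℝ} (hH0 : 0 < H) (hH1 : H < 1) :
    ∫ z in Ioi (0 : ℝ), (1 - Real.cos z) * z ^ (-(1 + 2 * H)) = 1 / (4 * CH H ^ 2) := by
  have hG := Real.Gamma_pos_of_pos (show 0 < 1 + 2 * H by linarith)
  have hG1 := Real.Gamma_pos_of_pos (show 0 < 2 * H by linarith)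
  have hG2 := Real.Gamma_pos_of_pos hH0
  have hG3 := Real.Gamma_pos_of_pos (show 0 < 1 - H by linarith)
  have h2 : 0 < Real.sin (H * Real.pi) := Real.sin_pos_of_pos_of_lt_pi (by positivity)
    (by nlinarith [Real.pi_pos])
  rw [integral_eq_lintegral_of_nonneg_ae, lintegral_Ioi_one_sub_cos hH0 hH1,
    ENNReal.toReal_ofReal (by positivity), Real.Gamma_mul_Gamma_one_sub, CH_sq hH0 hH1,
    add_comm 1, Real.Gamma_add_one (by positivity), mul_comm Real.pi H]
  · field_simp
    norm_num
  · filter_upwards [ae_restrict_mem measurableSet_Ioi] with z hz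
    have : (0 : ℝ) < z := hz
    exact mul_nonneg (by linarith [Real.cos_le_one z]) (by positivity)
  · exact Measurable.aestronglyMeasurable (by fun_prop)

/-- The spectral representation of `|t| ^ (2 * H)`. -/
lemma integral_one_sub_cos {H : ℝ} (hH0 : 0 < H) (hH1 : H < 1) (t : ℝ) :
    ∫ z : ℝ, (1 - Real.cos (t * z)) * |z| ^ (-(1 + 2 * H)) =
      |t| ^ (2 * H) / (2 * CH H ^ 2) := by
  rcases eq_or_ne t 0 with rfl | ht
  · simp [Real.zero_rpow (show 2 * H ≠ 0 by positivity)]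
  have ht' : 0 < |t| := abs_pos.2 ht
  have h1 : ∀ z : ℝ, (1 - Real.cos (t * z)) * |z| ^ (-(1 + 2 * H)) =
      (fun r : ℝ ↦ (1 - Real.cos (|t| * r)) * r ^ (-(1 + 2 * H))) |z| := fun z ↦ by
    simp only
    rw [← abs_mul, Real.cos_abs]
  rw [integral_congr_ae (ae_of_all _ h1), integral_comp_abs (f := fun r : ℝ ↦ (1 - Real.cos (|t| * r)) * r ^ (-(1 + 2 * H)))]
  have h2 : ∫ z in Ioi (0 : ℝ), (1 - Real.cos (|t| * z)) * z ^ (-(1 + 2 * H)) =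
      |t| ^ (1 + 2 * H) * ∫ z in Ioi (0 : ℝ),
        (fun r ↦ (1 - Real.cos r) * r ^ (-(1 + 2 * H))) (|t| * z) := by
    rw [← integral_const_mul]
    refine setIntegral_congr_fun measurableSet_Ioi fun z hz ↦ ?_
    have hz' : (0 : ℝ) < z := hz
    simp only
    rw [Real.mul_rpow ht'.le hz'.le, Real.rpow_neg ht'.le]
    field_simp
  rw [h2, integral_comp_mul_left_Ioi (fun r ↦ (1 - Real.cos r) * r ^ (-(1 + 2 * H))) _ ht', mul_zero, integral_Ioi_one_sub_cos hH0 hH1,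
    Real.rpow_add ht', Real.rpow_one]
  have := CH_pos hH0 hH1
  simp only [smul_eq_mul]
  field_simp
  norm_num

lemma integrable_one_sub_cos {H : ℝ} (hH0 : 0 < H) (hH1 : H < 1) (t : ℝ) :
    Integrable fun z : ℝ ↦ (1 - Real.cos (t * z)) * |z| ^ (-(1 + 2 * H)) := by
  rcases eq_or_ne t 0 with rfl | ht
  · simp
  refine .of_integral_ne_zero ?_
  have := CH_pos hH0 hH1
  have : 0 < |t| := abs_pos.2 ht
  rw [integral_one_sub_cos hH0 hH1]
  positivity

/-! ### Quadratic forms with coefficients of zero sum, on the spectral and on the Gaussian side. -/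

lemma norm_sum_sq {ι : Type*} [Fintype ι] (z : ι → ℂ) :
    ‖∑ i, z i‖ ^ 2 = ∑ i, ∑ j, (z i * (starRingEnd ℂ) (z j)).re := by
  have : ((‖∑ i, z i‖ ^ 2 : ℝ) : ℂ) = ∑ i, ∑ j, z i * (starRingEnd ℂ) (z j) := by
    rw [← Finset.sum_mul_sum, ← map_sum, Complex.mul_conj, Complex.normSq_eq_norm_sq]
  rw [← Complex.ofReal_re (‖_‖ ^ 2), this]
  simp only [Complex.re_sum]

/-- Coefficients of zero sum annihilate whatever depends on one index only. This removes the terms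
`|p i|^{2H}` from the covariance and the constant from `1 - cos`. -/
lemma sum_sum_re_mul_conj_mul {ι : Type*} [Fintype ι] (d : ι → ℂ) (hd : ∑ i, d i = 0)
    (f : ι → ℝ) : ∑ i, ∑ j, (d i * (starRingEnd ℂ) (d j)).re * f i = 0 := by
  refine Finset.sum_eq_zero fun i _ ↦ ?_
  rw [← Finset.sum_mul, ← Complex.re_sum, ← Finset.mul_sum, ← map_sum, hd]
  simp

lemma sum_sum_re_mul_conj_mul' {ι : Type*} [Fintype ι] (d : ι → ℂ) (hd : ∑ i, d i = 0)
    (f : ι → ℝ) : ∑ i, ∑ j, (d i * (starRingEnd ℂ) (d j)).re * f j = 0 := by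
  rw [Finset.sum_comm, ← sum_sum_re_mul_conj_mul d hd f]
  refine Finset.sum_congr rfl fun i _ ↦ Finset.sum_congr rfl fun j _ ↦ ?_
  simp only [Complex.mul_re, Complex.conj_re, Complex.conj_im]
  ring

/-- The trigonometric polynomial `∑ᵢ dᵢ e^{-i ζ pᵢ}`. -/
def trigSum {ι : Type*} [Fintype ι] (d : ι → ℂ) (p : ι → ℝ) (z : ℝ) : ℂ :=
  ∑ i, d i * Complex.exp (-(Complex.I * z * p i))

lemma continuous_trigSum {ι : Type*} [Fintype ι] (d : ι → ℂ) (p : ι → ℝ) :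
    Continuous (trigSum d p) := by
  unfold trigSum
  fun_prop

/-- For complex coefficients a single `‖trigSum d p z‖²` contains sine terms; they are odd in `z`
and cancel in the symmetrised sum. -/
lemma norm_trigSum_sq_add {ι : Type*} [Fintype ι] (d : ι → ℂ) (hd : ∑ i, d i = 0) (p : ι → ℝ)
    (z : ℝ) : ‖trigSum d p z‖ ^ 2 + ‖trigSum d p (-z)‖ ^ 2 =
      ∑ i, ∑ j, (-2 * (d i * (starRingEnd ℂ) (d j)).re) * (1 - Real.cos ((p i - p j) * z)) := by
  have h0 := sum_sum_re_mul_conj_mul d hd 1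
  simp only [Pi.one_apply, mul_one] at h0
  replace h0 := congrArg (2 * ·) h0
  simp only [mul_zero, Finset.mul_sum] at h0
  rw [trigSum, trigSum, norm_sum_sq, norm_sum_sq, ← Finset.sum_add_distrib, ← sub_eq_zero,
    ← h0, ← Finset.sum_sub_distrib]
  refine Finset.sum_congr rfl fun i _ ↦ ?_
  rw [← Finset.sum_add_distrib, ← Finset.sum_sub_distrib]
  refine Finset.sum_congr rfl fun j _ ↦ ?_
  simp only [map_mul, ← Complex.exp_conj, map_neg, Complex.conj_I, Complex.conj_ofReal,
    Complex.ofReal_neg]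
  have e : ∀ s : ℝ, (d i * Complex.exp (-(Complex.I * s * p i)) *
      ((starRingEnd ℂ) (d j) * Complex.exp (-(-Complex.I * s * p j)))).re =
      (d i * (starRingEnd ℂ) (d j)).re * Real.cos ((p i - p j) * s)
        + (d i * (starRingEnd ℂ) (d j)).im * Real.sin ((p i - p j) * s) := by
    intro s
    rw [mul_mul_mul_comm, ← Complex.exp_add, show -(Complex.I * s * p i) + -(-Complex.I * s * p j)
      = ((-((p i - p j) * s) : ℝ) : ℂ) * Complex.I by push_cast; ring, Complex.mul_re,
      Complex.exp_ofReal_mul_I_re, Complex.exp_ofReal_mul_I_im, Real.cos_neg, Real.sin_neg]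
    ring
  have h2 := e (-z)
  rw [Complex.ofReal_neg] at h2
  rw [e, h2]
  simp only [mul_neg, Real.cos_neg, Real.sin_neg]
  ring

lemma integral_norm_trigSum_sq {H : ℝ} (hH0 : 0 < H) (hH1 : H < 1) {ι : Type*} [Fintype ι]
    (d : ι → ℂ) (hd : ∑ i, d i = 0) (p : ι → ℝ) :
    Integrable (fun z : ℝ ↦ ‖trigSum d p z‖ ^ 2 * |z| ^ (-(1 + 2 * H))) ∧
    CH H ^ 2 * ∫ z : ℝ, ‖trigSum d p z‖ ^ 2 * |z| ^ (-(1 + 2 * H)) =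
      ∑ i, ∑ j, (d i * (starRingEnd ℂ) (d j)).re * (-(|p i - p j| ^ (2 * H)) / 2) := by
  set F : ℝ → ℝ := fun z ↦ ‖trigSum d p z‖ ^ 2 * |z| ^ (-(1 + 2 * H)) with hF
  have hFm : Measurable F := by
    have := (continuous_trigSum d p).measurable
    fun_prop
  have hF0 : ∀ z, 0 ≤ F z := fun z ↦ by positivity
  have hsum : ∀ z, F z + F (-z) = ∑ i, ∑ j, (-2 * (d i * (starRingEnd ℂ) (d j)).re) *
      ((1 - Real.cos ((p i - p j) * z)) * |z| ^ (-(1 + 2 * H))) := by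
    intro z
    simp only [hF, abs_neg]
    rw [← add_mul, norm_trigSum_sq_add d hd, Finset.sum_mul]
    simp only [Finset.sum_mul, mul_assoc]
  have hi : Integrable fun z ↦ F z + F (-z) := by
    simp_rw [hsum]
    exact integrable_finsetSum _ fun i _ ↦ integrable_finsetSum _ fun j _ ↦
      (integrable_one_sub_cos hH0 hH1 _).const_mul _
  -- `F ≥ 0` is dominated by its symmetrisation `F z + F (-z)`, whose integral is twice that of `F`.
  have hFi : Integrable F := hi.mono' hFm.aestronglyMeasurable <| ae_of_all _ fun z ↦ by
    rw [Real.norm_of_nonneg (hF0 z)]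
    linarith [hF0 (-z)]
  refine ⟨hFi, ?_⟩
  have h2 : 2 * ∫ z, F z = ∫ z, (F z + F (-z)) := by
    rw [integral_add hFi hFi.comp_neg, integral_neg_eq_self, two_mul]
  have hC := CH_pos hH0 hH1
  have h3 : ∫ z, (F z + F (-z)) = ∑ i, ∑ j, (-2 * (d i * (starRingEnd ℂ) (d j)).re) *
      (|p i - p j| ^ (2 * H) / (2 * CH H ^ 2)) := by
    simp_rw [hsum]
    rw [integral_finsetSum _ fun i _ ↦ integrable_finsetSum _ fun j _ ↦
      (integrable_one_sub_cos hH0 hH1 _).const_mul _]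
    refine Finset.sum_congr rfl fun i _ ↦ ?_
    rw [integral_finsetSum _ fun j _ ↦ (integrable_one_sub_cos hH0 hH1 _).const_mul _]
    refine Finset.sum_congr rfl fun j _ ↦ ?_
    rw [integral_const_mul, integral_one_sub_cos hH0 hH1]
  rw [show ∫ z, F z = (∫ z, (F z + F (-z))) / 2 by rw [← h2]; ring, h3, Finset.sum_div,
    Finset.mul_sum]
  refine Finset.sum_congr rfl fun i _ ↦ ?_
  rw [Finset.sum_div, Finset.mul_sum]
  refine Finset.sum_congr rfl fun j _ ↦ ?_
  field_simp

section Isometry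

variable {Ω : Type*} [MeasurableSpace Ω] {P : Measure Ω} {H : ℝ} {B : ℝ → Ω → ℝ}

lemma IsFBM.memLp (hB : IsFBM P H B) (x : ℝ) : MemLp (B x) 2 P :=
  (hB.gaussian.hasGaussianLaw_eval x).memLp_two

/-- The right side is that of `integral_norm_trigSum_sq`, so comparing second moments gives the
isometry without a spectral representation of the process itself. -/
lemma IsFBM.integral_norm_sum_sq (hB : IsFBM P H B) {ι : Type*} [Fintype ι]
    (d : ι → ℂ) (hd : ∑ i, d i = 0) (p : ι → ℝ) :
    ∫ ϖ, ‖∑ i, d i * (B (p i) ϖ : ℂ)‖ ^ 2 ∂P =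
      ∑ i, ∑ j, (d i * (starRingEnd ℂ) (d j)).re * (-(|p i - p j| ^ (2 * H)) / 2) := by
  have h1 : ∀ ϖ, ‖∑ i, d i * (B (p i) ϖ : ℂ)‖ ^ 2 =
      ∑ i, ∑ j, (d i * (starRingEnd ℂ) (d j)).re * (B (p i) ϖ * B (p j) ϖ) := by
    intro ϖ
    rw [norm_sum_sq]
    refine Finset.sum_congr rfl fun i _ ↦ Finset.sum_congr rfl fun j _ ↦ ?_
    simp
    ring
  have hint : ∀ i j, Integrable (fun ϖ ↦ (d i * (starRingEnd ℂ) (d j)).re *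
      (B (p i) ϖ * B (p j) ϖ)) P := fun i j ↦
    ((hB.memLp (p i)).integrable_mul (hB.memLp (p j))).const_mul _
  simp_rw [h1]
  rw [integral_finsetSum _ fun i _ ↦ integrable_finsetSum _ fun j _ ↦ hint i j]
  have h2 := sum_sum_re_mul_conj_mul d hd fun i ↦ |p i| ^ (2 * H) / 2
  have h3 := sum_sum_re_mul_conj_mul' d hd fun i ↦ |p i| ^ (2 * H) / 2
  rw [← add_zero (∑ i, ∑ j, (d i * (starRingEnd ℂ) (d j)).re * (-(|p i - p j| ^ (2 * H)) / 2)),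
    ← h2, ← Finset.sum_add_distrib, ← add_zero (∑ i, (_ + _)), ← h3, ← Finset.sum_add_distrib]
  refine Finset.sum_congr rfl fun i _ ↦ ?_
  rw [integral_finsetSum _ fun j _ ↦ hint i j, ← Finset.sum_add_distrib, ← Finset.sum_add_distrib]
  refine Finset.sum_congr rfl fun j _ ↦ ?_
  rw [integral_const_mul, hB.covariance]
  ring

end Isometry

/-! ### `L²` norms and Plancherel's theorem. -/

lemma eLpNorm_two_sq {α E : Type*} [MeasurableSpace α] [NormedAddCommGroup E] (f : α → E)
    (μ : Measure α) : eLpNorm f 2 μ ^ 2 = ∫⁻ x, ‖f x‖ₑ ^ 2 ∂μ := by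
  simpa using eLpNorm_nnreal_pow_eq_lintegral (f := f) (μ := μ) (p := 2) two_ne_zero

lemma eLpNorm_two_sq_eq_ofReal {α E : Type*} [MeasurableSpace α] [NormedAddCommGroup E]
    {f : α → E} {μ : Measure α} (hf : MemLp f 2 μ) :
    eLpNorm f 2 μ ^ 2 = ENNReal.ofReal (∫ x, ‖f x‖ ^ 2 ∂μ) := by
  rw [eLpNorm_two_sq, ofReal_integral_eq_lintegral_ofReal hf.norm.integrable_sq
    (ae_of_all _ fun x ↦ by positivity)]
  refine lintegral_congr fun x ↦ ?_
  rw [ENNReal.ofReal_pow (norm_nonneg _), ofReal_norm]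

section Plancherel
open scoped FourierTransform SchwartzMap

/-- The `L²` transform and the integral transform agree as tempered distributions: both, tested
against a smooth compactly supported `g`, give `∫ ĝ f`. -/
lemma coeFn_fourier_toLp {f : ℝ → ℂ} (hf : Integrable f) (hf2 : MemLp f 2) :
    ((𝓕 (hf2.toLp f) : Lp ℂ 2 (volume : Measure ℝ)) : ℝ → ℂ) =ᵐ[volume] 𝓕 f := by
  have hcont : Continuous (𝓕 f) := VectorFourier.fourierIntegral_continuous
    Real.continuous_fourierChar (innerSL ℝ).continuous₂ hf
  refine ae_eq_of_integral_contDiff_smul_eq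
    ((Lp.memLp _).locallyIntegrable one_le_two) hcont.locallyIntegrable fun g hg hgs ↦ ?_
  have hgs' : HasCompactSupport fun x ↦ (g x : ℂ) :=
    hgs.comp_left (g := fun r : ℝ ↦ (r : ℂ)) Complex.ofReal_zero
  let ψ : 𝓢(ℝ, ℂ) := hgs'.toSchwartzMap (Complex.ofRealCLM.contDiff.comp hg)
  have hψ : ∀ x, ψ x = (g x : ℂ) := fun x ↦ rfl
  have h := DFunLike.congr_fun (Lp.fourier_toTemperedDistribution_eq (hf2.toLp f)) ψ
  rw [TemperedDistribution.fourier_apply, Lp.toTemperedDistribution_apply,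
    Lp.toTemperedDistribution_apply] at h
  have h1 : ∫ x, (𝓕 ψ) x • (hf2.toLp f) x = ∫ x, (𝓕 ψ) x • f x :=
    integral_congr_ae <| by
      filter_upwards [hf2.coeFn_toLp] with x hx
      rw [hx]
  have h2 := VectorFourier.integral_fourierIntegral_smul_eq_flip (μ := volume) (ν := volume)
      (L := innerₗ ℝ) Real.continuous_fourierChar (innerSL ℝ).continuous₂ ψ.integrable hf
  rw [flip_innerₗ] at h2
  have h3 : VectorFourier.fourierIntegral Real.fourierChar volume (innerₗ ℝ) f = 𝓕 f := rfl
  rw [h3] at h2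
  simpa [hψ] using (h.symm.trans h1).trans h2

lemma eLpNorm_fourier {f : ℝ → ℂ} (hf : Integrable f) (hf2 : MemLp f 2) :
    eLpNorm (𝓕 f) 2 volume = eLpNorm f 2 volume := by
  rw [← eLpNorm_congr_ae (coeFn_fourier_toLp hf hf2), ← eLpNorm_congr_ae hf2.coeFn_toLp,
    ← Lp.enorm_def, ← Lp.enorm_def, ← ofReal_norm, ← ofReal_norm,
    Lp.norm_fourier_eq]

lemma fourierT_eq_fourier (f : ℝ → ℂ) (z : ℝ) : fourierT f z = 𝓕 f (z * (2 * Real.pi)⁻¹) := by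
  rw [fourierT, Real.fourier_eq']
  refine integral_congr_ae (ae_of_all _ fun y ↦ ?_)
  simp only [smul_eq_mul, RCLike.inner_apply, conj_trivial]
  rw [mul_comm]
  congr 2
  have := Real.pi_ne_zero
  push_cast
  field_simp

lemma continuous_fourierT {f : ℝ → ℂ} (hf : Integrable f) : Continuous (fourierT f) := by
  have hcont : Continuous (𝓕 f) := VectorFourier.fourierIntegral_continuous
    Real.continuous_fourierChar (innerSL ℝ).continuous₂ hf
  simp_rw [funext (fourierT_eq_fourier f)]
  fun_prop

/-- Plancherel's theorem on `L¹ ∩ L²`. -/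
lemma lintegral_enorm_fourierT_sq {f : ℝ → ℂ} (hf : Integrable f) (hf2 : MemLp f 2) :
    ∫⁻ z, ‖fourierT f z‖ₑ ^ 2 = ENNReal.ofReal (2 * Real.pi) * ∫⁻ y, ‖f y‖ₑ ^ 2 := by
  have h := Real.pi_pos
  simp_rw [fourierT_eq_fourier]
  rw [← eLpNorm_two_sq f, ← eLpNorm_fourier hf hf2, eLpNorm_two_sq]
  have hm : Measurable (𝓕 f) := (VectorFourier.fourierIntegral_continuous
    Real.continuous_fourierChar (innerSL ℝ).continuous₂ hf).measurable
  rw [← lintegral_map (g := fun z : ℝ ↦ z * (2 * Real.pi)⁻¹) (f := fun z ↦ ‖𝓕 f z‖ₑ ^ 2)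
    (by fun_prop) (by fun_prop), Real.map_volume_mul_right (by positivity), lintegral_smul_measure,
    inv_inv, abs_of_pos (by positivity), smul_eq_mul]

end Plancherel

/-! ### Fourier integrals of step functions and the isometry for elementary integrals. -/

lemma norm_exp_neg_I_mul (z y : ℝ) : ‖Complex.exp (-(Complex.I * z * y))‖ = 1 := by
  rw [Complex.norm_exp]
  simp

lemma integrable_fourierT_integrand {f : ℝ → ℂ} (hf : Integrable f) (z : ℝ) :
    Integrable fun y : ℝ ↦ f y * Complex.exp (-(Complex.I * z * y)) := by
  refine hf.mul_bdd (c := 1) (Continuous.aestronglyMeasurable (by fun_prop)) ?_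
  exact ae_of_all _ fun y ↦ (norm_exp_neg_I_mul z y).le

lemma fourierT_sub {f g : ℝ → ℂ} (hf : Integrable f) (hg : Integrable g) :
    fourierT (f - g) = fourierT f - fourierT g := by
  ext z
  simp only [fourierT, Pi.sub_apply, sub_mul]
  exact integral_sub (integrable_fourierT_integrand hf z) (integrable_fourierT_integrand hg z)

lemma norm_fourierT_le (f : ℝ → ℂ) (z : ℝ) : ‖fourierT f z‖ ≤ ∫ y, ‖f y‖ := by
  refine (norm_integral_le_integral_norm _).trans_eq ?_
  simp only [norm_mul, norm_exp_neg_I_mul, mul_one]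

lemma fourierT_comp_add_right (f : ℝ → ℂ) (h z : ℝ) :
    fourierT (fun y ↦ f (y + h)) z = Complex.exp (Complex.I * z * h) * fourierT f z := by
  rw [fourierT, fourierT, ← integral_const_mul,
    ← integral_add_right_eq_self (fun y : ℝ ↦ _ * (f y * _)) h]
  refine integral_congr_ae (ae_of_all _ fun y ↦ ?_)
  simp only
  rw [mul_left_comm, ← Complex.exp_add]
  push_cast
  ring_nf

/-- The step function `∑ₖ cₖ 1_{(aₖ, bₖ]}`. -/
def stepFun {ι : Type*} [Fintype ι] (a b : ι → ℝ) (c : ι → ℂ) (y : ℝ) : ℂ :=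
  ∑ k, indicator (Ioc (a k) (b k)) (fun _ ↦ c k) y

/-- The elementary integral `∑ₖ cₖ (B(bₖ) - B(aₖ))`. -/
def stepInt {Ω ι : Type*} [Fintype ι] (B : ℝ → Ω → ℝ) (a b : ι → ℝ) (c : ι → ℂ) (ϖ : Ω) : ℂ :=
  ∑ k, c k * ((B (b k) ϖ - B (a k) ϖ : ℝ) : ℂ)

/-- The weight `|ζ|^{1-2H} dζ`. -/
def specMeasure (H : ℝ) : Measure ℝ :=
  volume.withDensity fun z ↦ ENNReal.ofReal (|z| ^ (1 - 2 * H))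

section Step

variable {ι κ : Type*} [Fintype ι] [Fintype κ]

lemma memLp_stepFun (a b : ι → ℝ) (c : ι → ℂ) (p : ℝ≥0∞) : MemLp (stepFun a b c) p :=
  memLp_finsetSum _ fun k _ ↦ memLp_indicator_const p measurableSet_Ioc (c k)
    (Or.inr (by simp))

lemma integrable_stepFun (a b : ι → ℝ) (c : ι → ℂ) : Integrable (stepFun a b c) :=
  memLp_one_iff_integrable.1 (memLp_stepFun a b c 1)

/-- The factor `i z` is kept on the left so that the identity also holds at `z = 0`. -/
lemma mul_fourierT_indicator {a b : ℝ} (hab : a ≤ b) (c : ℂ) (z : ℝ) :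
    Complex.I * z * fourierT (indicator (Ioc a b) fun _ ↦ c) z =
      c * (Complex.exp (-(Complex.I * z * a)) - Complex.exp (-(Complex.I * z * b))) := by
  rcases eq_or_ne z 0 with rfl | hz
  · simp
  have hz' : -(Complex.I * (z : ℂ)) ≠ 0 := by simp [hz]
  have h1 : fourierT (indicator (Ioc a b) fun _ ↦ c) z =
      c * ∫ y in a..b, Complex.exp (-(Complex.I * z) * y) := by
    rw [intervalIntegral.integral_of_le hab, ← integral_const_mul,
      ← integral_indicator measurableSet_Ioc, fourierT]
    refine integral_congr_ae (ae_of_all _ fun y ↦ ?_)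
    by_cases hy : y ∈ Ioc a b <;> simp [hy]
  rw [h1, integral_exp_mul_complex hz']
  have hz'' : (z : ℂ) ≠ 0 := by exact_mod_cast hz
  simp only [neg_mul]
  field_simp
  ring

lemma fourierT_stepFun (a b : ι → ℝ) (c : ι → ℂ) (z : ℝ) :
    fourierT (stepFun a b c) z = ∑ k, fourierT (indicator (Ioc (a k) (b k)) fun _ ↦ c k) z := by
  simp only [fourierT, stepFun, Finset.sum_mul]
  exact integral_finsetSum _ fun k _ ↦ integrable_fourierT_integrand
    ((integrable_indicator_iff measurableSet_Ioc).2 (by simp)) z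

lemma mul_fourierT_stepFun {a b : ι → ℝ} (hab : ∀ k, a k ≤ b k) (c : ι → ℂ) (z : ℝ) :
    Complex.I * z * fourierT (stepFun a b c) z = ∑ k, c k *
      (Complex.exp (-(Complex.I * z * a k)) - Complex.exp (-(Complex.I * z * b k))) := by
  rw [fourierT_stepFun, Finset.mul_sum]
  exact Finset.sum_congr rfl fun k _ ↦ mul_fourierT_indicator (hab k) _ _

lemma mul_fourierT_stepFun_eq_trigSum {a b : ι → ℝ} (hab : ∀ k, a k ≤ b k) (c : ι → ℂ) (z : ℝ) :
    Complex.I * z * fourierT (stepFun a b c) z = - trigSum (Sum.elim c (-c)) (Sum.elim b a) z := by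
  rw [mul_fourierT_stepFun hab, trigSum, Fintype.sum_sum_type, ← Finset.sum_add_distrib,
    ← Finset.sum_neg_distrib]
  refine Finset.sum_congr rfl fun k _ ↦ ?_
  simp
  ring

lemma stepInt_eq_sum {Ω : Type*} (B : ℝ → Ω → ℝ) (a b : ι → ℝ) (c : ι → ℂ) (ϖ : Ω) :
    stepInt B a b c ϖ = ∑ i : ι ⊕ ι, Sum.elim c (-c) i * (B (Sum.elim b a i) ϖ : ℂ) := by
  rw [stepInt, Fintype.sum_sum_type, ← Finset.sum_add_distrib]
  refine Finset.sum_congr rfl fun k _ ↦ ?_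
  simp
  ring

lemma stepFun_sub (a b : ι → ℝ) (c : ι → ℂ) (a' b' : κ → ℝ) (c' : κ → ℂ) :
    stepFun a b c - stepFun a' b' c' =
      stepFun (Sum.elim a a') (Sum.elim b b') (Sum.elim c (-c')) := by
  ext y
  simp only [stepFun, Pi.sub_apply, Fintype.sum_sum_type, Sum.elim_inl, Sum.elim_inr,
    Pi.neg_apply, indicator_neg, Finset.sum_neg_distrib, sub_eq_add_neg]

lemma stepInt_sub {Ω : Type*} (B : ℝ → Ω → ℝ) (a b : ι → ℝ) (c : ι → ℂ) (a' b' : κ → ℝ)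
    (c' : κ → ℂ) : stepInt B a b c - stepInt B a' b' c' =
      stepInt B (Sum.elim a a') (Sum.elim b b') (Sum.elim c (-c')) := by
  ext ϖ
  simp only [stepInt, Pi.sub_apply, Fintype.sum_sum_type, Sum.elim_inl, Sum.elim_inr,
    Pi.neg_apply, neg_mul, Finset.sum_neg_distrib, sub_eq_add_neg]

variable {Ω : Type*} [MeasurableSpace Ω] {P : Measure Ω} {H : ℝ} {B : ℝ → Ω → ℝ}

lemma IsFBM.memLp_stepInt (hB : IsFBM P H B) (a b : ι → ℝ) (c : ι → ℂ) :
    MemLp (stepInt B a b c) 2 P :=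
  memLp_finsetSum _ fun k _ ↦ (((hB.memLp (b k)).sub (hB.memLp (a k))).ofReal).const_mul (c k)

lemma lintegral_specMeasure {f : ℝ → ℂ} (hf : Measurable f) (H : ℝ) :
    ∫⁻ z, ‖f z‖ₑ ^ 2 ∂(specMeasure H) =
      ∫⁻ z, ENNReal.ofReal (‖f z‖ ^ 2 * |z| ^ (1 - 2 * H)) := by
  rw [specMeasure, lintegral_withDensity_eq_lintegral_mul _ (by fun_prop) (by fun_prop)]
  refine lintegral_congr fun z ↦ ?_
  rw [Pi.mul_apply, mul_comm, ENNReal.ofReal_mul (by positivity),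
    ENNReal.ofReal_pow (norm_nonneg _), ofReal_norm]

/-- The spectral isometry for elementary integrals. -/
lemma IsFBM.eLpNorm_stepInt (hB : IsFBM P H B) (hH0 : 0 < H) (hH1 : H < 1)
    {a b : ι → ℝ} (hab : ∀ k, a k ≤ b k) (c : ι → ℂ) :
    eLpNorm (stepInt B a b c) 2 P =
      ENNReal.ofReal (CH H) * eLpNorm (fourierT (stepFun a b c)) 2 (specMeasure H) := by
  have hd : ∑ i, (Sum.elim c (-c)) i = 0 := by simp [Fintype.sum_sum_type]
  obtain ⟨hi, h1⟩ := integral_norm_trigSum_sq hH0 hH1 _ hd (Sum.elim b a)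
  have h2 := hB.integral_norm_sum_sq _ hd (Sum.elim b a)
  simp_rw [← stepInt_eq_sum] at h2
  refine (ENNReal.pow_right_strictMono two_ne_zero).injective ?_
  rw [mul_pow, eLpNorm_two_sq_eq_ofReal (hB.memLp_stepInt a b c), h2, ← h1, eLpNorm_two_sq,
    lintegral_specMeasure (continuous_fourierT (integrable_stepFun a b c)).measurable,
    ENNReal.ofReal_mul (by positivity), ENNReal.ofReal_pow (CH_nonneg H),
    ofReal_integral_eq_lintegral_ofReal hi (ae_of_all _ fun z ↦ by positivity)]
  congr 1
  refine lintegral_congr_ae ?_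
  -- Off the null set `{0}`, `|trigSum| = |z| |φ̂|`, and the factor `|z|²` turns the weight
  -- `|z|^{-(1 + 2H)}` into `|z|^{1 - 2H}`.
  filter_upwards [(countable_singleton (0 : ℝ)).ae_notMem volume] with z hz
  have hz' : 0 < |z| := abs_pos.2 fun h ↦ hz h
  have h3 := congrArg norm (mul_fourierT_stepFun_eq_trigSum hab c z)
  rw [norm_neg, norm_mul, norm_mul, Complex.norm_I, one_mul, Complex.norm_real,
    Real.norm_eq_abs] at h3
  rw [← h3, mul_pow, mul_comm (|z| ^ 2), mul_assoc, ← Real.rpow_natCast |z| 2,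
    ← Real.rpow_add hz']
  congr 3
  push_cast
  ring

end Step

/-! ### Extension of the isometry to limits of step functions. -/

lemma tendsto_ennreal_of_le_add {u δ : ℕ → ℝ≥0∞} {a : ℝ≥0∞} (hδ : Tendsto δ atTop (𝓝 0))
    (h1 : ∀ n, u n ≤ a + δ n) (h2 : ∀ n, a ≤ u n + δ n) : Tendsto u atTop (𝓝 a) := by
  refine tendsto_of_tendsto_of_tendsto_of_le_of_le (g := fun n ↦ a - δ n) (h := fun n ↦ a + δ n)
    ?_ ?_ (fun n ↦ tsub_le_iff_right.2 (h2 n)) h1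
  · simpa using ENNReal.Tendsto.sub tendsto_const_nhds hδ (Or.inr ENNReal.zero_ne_top)
  · simpa using tendsto_const_nhds.add hδ

lemma tendsto_eLpNorm_of_tendsto_sub {α E : Type*} [MeasurableSpace α] [NormedAddCommGroup E]
    {μ : Measure α} {u : ℕ → α → E} {v : α → E} (hu : ∀ n, AEStronglyMeasurable (u n) μ)
    (hv : AEStronglyMeasurable v μ) (h : Tendsto (fun n ↦ eLpNorm (u n - v) 2 μ) atTop (𝓝 0)) :
    Tendsto (fun n ↦ eLpNorm (u n) 2 μ) atTop (𝓝 (eLpNorm v 2 μ)) := by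
  refine tendsto_ennreal_of_le_add h (fun n ↦ ?_) fun n ↦ ?_
  · simpa using eLpNorm_add_le hv ((hu n).sub hv) one_le_two
  · rw [eLpNorm_sub_comm]
    simpa using eLpNorm_add_le (hu n) (hv.sub (hu n)) one_le_two

lemma exists_tendsto_eLpNorm_sub {α E : Type*} [MeasurableSpace α] [NormedAddCommGroup E]
    [CompleteSpace E] {μ : Measure α} {u : ℕ → α → E} (hu : ∀ n, MemLp (u n) 2 μ)
    {e : ℕ → ℝ≥0∞} (he : Tendsto e atTop (𝓝 0))
    (h : ∀ m n, eLpNorm (u m - u n) 2 μ ≤ e m + e n) :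
    ∃ v, MemLp v 2 μ ∧ Tendsto (fun n ↦ eLpNorm (u n - v) 2 μ) atTop (𝓝 0) := by
  have hc : CauchySeq fun n ↦ (hu n).toLp (u n) := by
    rw [EMetric.cauchySeq_iff]
    intro ε hε
    obtain ⟨N, hN⟩ := eventually_atTop.1 (he.eventually_lt_const (ENNReal.half_pos hε.ne'))
    refine ⟨N, fun m hm n hn ↦ ?_⟩
    rw [Lp.edist_toLp_toLp]
    exact (h m n).trans_lt ((ENNReal.add_lt_add (hN m hm) (hN n hn)).trans_eq
      (ENNReal.add_halves ε))
  obtain ⟨v, hv⟩ := cauchySeq_tendsto_of_complete hc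
  refine ⟨v, Lp.memLp v, ?_⟩
  rw [Lp.tendsto_Lp_iff_tendsto_eLpNorm'] at hv
  exact hv.congr fun n ↦ eLpNorm_congr_ae ((hu n).coeFn_toLp.sub .rfl)

lemma IsStepIntegral.exists_eq {Ω : Type*} {B : ℝ → Ω → ℝ} {φ : ℝ → ℂ} {Y : Ω → ℂ} (h : IsStepIntegral B φ Y) :
    ∃ (N : ℕ) (a b : Fin N → ℝ) (c : Fin N → ℂ), (∀ k, a k ≤ b k) ∧ φ = stepFun a b c ∧
      Y = stepInt B a b c := h

lemma IsStepIntegral.integrable {Ω : Type*} {B : ℝ → Ω → ℝ} {φ : ℝ → ℂ} {Y : Ω → ℂ} (h : IsStepIntegral B φ Y) :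
    Integrable φ := by
  obtain ⟨N, a, b, c, -, rfl, -⟩ := h.exists_eq
  exact integrable_stepFun a b c

lemma IsStepIntegral.memLp_fun {Ω : Type*} {B : ℝ → Ω → ℝ} {φ : ℝ → ℂ} {Y : Ω → ℂ} (h : IsStepIntegral B φ Y) :
    MemLp φ 2 := by
  obtain ⟨N, a, b, c, -, rfl, -⟩ := h.exists_eq
  exact memLp_stepFun a b c 2

section Approx

variable {Ω : Type*} [MeasurableSpace Ω] {P : Measure Ω} {H : ℝ} {B : ℝ → Ω → ℝ}

lemma IsStepIntegral.memLp (hB : IsFBM P H B) {φ : ℝ → ℂ} {Y : Ω → ℂ}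
    (h : IsStepIntegral B φ Y) : MemLp Y 2 P := by
  obtain ⟨N, a, b, c, -, -, rfl⟩ := h.exists_eq
  exact hB.memLp_stepInt a b c

lemma IsStepIntegral.eLpNorm_sub (hB : IsFBM P H B) (hH0 : 0 < H) (hH1 : H < 1)
    {φ φ' : ℝ → ℂ} {Y Y' : Ω → ℂ} (h : IsStepIntegral B φ Y) (h' : IsStepIntegral B φ' Y') :
    eLpNorm (Y - Y') 2 P =
      ENNReal.ofReal (CH H) * eLpNorm (fourierT (φ - φ')) 2 (specMeasure H) := by
  obtain ⟨N, a, b, c, hab, rfl, rfl⟩ := h.exists_eq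
  obtain ⟨N', a', b', c', hab', rfl, rfl⟩ := h'.exists_eq
  rw [stepFun_sub, stepInt_sub]
  refine hB.eLpNorm_stepInt hH0 hH1 ?_ _
  rintro (k | k)
  exacts [hab k, hab' k]

/-- `Y` is the mean square limit of the elementary integrals of step functions that converge to
the integrable function `φ` in the spectral norm. -/
def IsSpectralIntegral (P : Measure Ω) (H : ℝ) (B : ℝ → Ω → ℝ) (φ : ℝ → ℂ) (Y : Ω → ℂ) : Prop :=
  Integrable φ ∧ MemLp Y 2 P ∧ ∃ (ψ : ℕ → ℝ → ℂ) (Z : ℕ → Ω → ℂ),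
    (∀ m, IsStepIntegral B (ψ m) (Z m)) ∧
    Tendsto (fun m ↦ eLpNorm (Z m - Y) 2 P) atTop (𝓝 0) ∧
    Tendsto (fun m ↦ eLpNorm (fourierT (ψ m - φ)) 2 (specMeasure H)) atTop (𝓝 0)

lemma IsStepIntegral.isSpectralIntegral (hB : IsFBM P H B) {φ : ℝ → ℂ} {Y : Ω → ℂ}
    (h : IsStepIntegral B φ Y) : IsSpectralIntegral P H B φ Y := by
  refine ⟨h.integrable, h.memLp hB, fun _ ↦ φ, fun _ ↦ Y, fun _ ↦ h, by simp, ?_⟩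
  have : fourierT (0 : ℝ → ℂ) = 0 := by ext; simp [fourierT]
  simp [this]

lemma isSpectralIntegral_zero (hB : IsFBM P H B) : IsSpectralIntegral P H B 0 0 := by
  refine IsStepIntegral.isSpectralIntegral hB ⟨0, 0, 0, 0, by simp, ?_, ?_⟩ <;> ext <;> simp

lemma aestronglyMeasurable_fourierT {φ : ℝ → ℂ} (hφ : Integrable φ) (μ : Measure ℝ) :
    AEStronglyMeasurable (fourierT φ) μ :=
  (continuous_fourierT hφ).aestronglyMeasurable

/-- The spectral isometry. -/
lemma IsSpectralIntegral.eLpNorm_sub (hB : IsFBM P H B) (hH0 : 0 < H) (hH1 : H < 1)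
    {φ φ' : ℝ → ℂ} {Y Y' : Ω → ℂ} (h : IsSpectralIntegral P H B φ Y)
    (h' : IsSpectralIntegral P H B φ' Y') :
    eLpNorm (Y - Y') 2 P =
      ENNReal.ofReal (CH H) * eLpNorm (fourierT (φ - φ')) 2 (specMeasure H) := by
  obtain ⟨hφ, hY, ψ, Z, hs, hZ, hψ⟩ := h
  obtain ⟨hφ', hY', ψ', Z', hs', hZ', hψ'⟩ := h'
  have hZm := fun m ↦ (hs m).memLp hB
  have hZm' := fun m ↦ (hs' m).memLp hB
  have h1 : Tendsto (fun m ↦ eLpNorm (Z m - Z' m) 2 P) atTop (𝓝 (eLpNorm (Y - Y') 2 P)) := by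
    refine tendsto_eLpNorm_of_tendsto_sub (fun m ↦ ((hZm m).sub (hZm' m)).1) (hY.sub hY').1
      (tendsto_of_tendsto_of_tendsto_of_le_of_le tendsto_const_nhds
        (by simpa using hZ.add hZ') (fun _ ↦ zero_le) fun m ↦ ?_)
    simp only
    rw [sub_sub_sub_comm]
    exact eLpNorm_sub_le ((hZm m).sub hY).1 ((hZm' m).sub hY').1 one_le_two
  have h2 : Tendsto (fun m ↦ eLpNorm (fourierT (ψ m - ψ' m)) 2 (specMeasure H)) atTop
      (𝓝 (eLpNorm (fourierT (φ - φ')) 2 (specMeasure H))) := by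
    have hi := fun m ↦ (hs m).integrable
    have hi' := fun m ↦ (hs' m).integrable
    refine tendsto_eLpNorm_of_tendsto_sub
      (fun m ↦ aestronglyMeasurable_fourierT ((hi m).sub (hi' m)) _)
      (aestronglyMeasurable_fourierT (hφ.sub hφ') _)
      (tendsto_of_tendsto_of_tendsto_of_le_of_le tendsto_const_nhds
        (by simpa using hψ.add hψ') (fun _ ↦ zero_le) fun m ↦ ?_)
    simp only
    rw [← fourierT_sub ((hi m).sub (hi' m)) (hφ.sub hφ'), sub_sub_sub_comm,
      fourierT_sub ((hi m).sub hφ) ((hi' m).sub hφ')]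
    exact eLpNorm_sub_le (aestronglyMeasurable_fourierT ((hi m).sub hφ) _)
      (aestronglyMeasurable_fourierT ((hi' m).sub hφ') _) one_le_two
  -- By the isometry for step functions the two sequences differ only by the factor `C_H`, hence so
  -- do their limits.
  refine tendsto_nhds_unique h1 ?_
  simp_rw [fun m ↦ (hs m).eLpNorm_sub hB hH0 hH1 (hs' m)]
  exact ENNReal.Tendsto.const_mul h2 (Or.inr ENNReal.ofReal_ne_top)

lemma IsSpectralIntegral.eLpNorm_eq (hB : IsFBM P H B) (hH0 : 0 < H) (hH1 : H < 1)
    {φ : ℝ → ℂ} {Y : Ω → ℂ} (h : IsSpectralIntegral P H B φ Y) :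
    eLpNorm Y 2 P = ENNReal.ofReal (CH H) * eLpNorm (fourierT φ) 2 (specMeasure H) := by
  simpa using h.eLpNorm_sub hB hH0 hH1 (isSpectralIntegral_zero hB)

/-- The isometry transfers the Cauchy property from the integrands to the elementary integrals;
completeness of `L²(P)` supplies the limit. -/
lemma exists_isSpectralIntegral (hB : IsFBM P H B) (hH0 : 0 < H) (hH1 : H < 1)
    {φ : ℝ → ℂ} (hφ : Integrable φ) {ψ : ℕ → ℝ → ℂ} {Z : ℕ → Ω → ℂ}
    (hs : ∀ m, IsStepIntegral B (ψ m) (Z m))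
    (hψ : Tendsto (fun m ↦ eLpNorm (fourierT (ψ m - φ)) 2 (specMeasure H)) atTop (𝓝 0)) :
    ∃ Y, IsSpectralIntegral P H B φ Y := by
  have hi := fun m ↦ (hs m).integrable
  have he : Tendsto (fun m ↦ ENNReal.ofReal (CH H) *
      eLpNorm (fourierT (ψ m - φ)) 2 (specMeasure H)) atTop (𝓝 0) := by
    simpa using ENNReal.Tendsto.const_mul hψ (Or.inr ENNReal.ofReal_ne_top)
  obtain ⟨Y, hY, hYZ⟩ := exists_tendsto_eLpNorm_sub (fun m ↦ (hs m).memLp hB) he fun m n ↦ by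
    rw [(hs m).eLpNorm_sub hB hH0 hH1 (hs n), ← mul_add]
    gcongr
    rw [← sub_sub_sub_cancel_right (ψ m) (ψ n) φ, fourierT_sub ((hi m).sub hφ) ((hi n).sub hφ)]
    exact eLpNorm_sub_le (aestronglyMeasurable_fourierT ((hi m).sub hφ) _)
      (aestronglyMeasurable_fourierT ((hi n).sub hφ) _) one_le_two
  exact ⟨Y, hφ, hY, ψ, Z, hs, hYZ, hψ⟩

end Approx

/-! ### Weighted `L²` estimates from Fourier decay of order `1 / |ζ|`. -/

lemma tendsto_ennreal_zero_of_sq {u : ℕ → ℝ≥0∞} (h : Tendsto (fun n ↦ u n ^ 2) atTop (𝓝 0)) :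
    Tendsto u atTop (𝓝 0) := by
  have := (ENNReal.continuous_rpow_const (y := (1 / 2 : ℝ))).tendsto 0 |>.comp h
  rw [ENNReal.zero_rpow_of_pos (by norm_num)] at this
  refine this.congr fun n ↦ ?_
  rw [Function.comp_apply, ← ENNReal.rpow_natCast, ← ENNReal.rpow_mul]
  norm_num

/-- Uniform smallness of weighted `L²` norms of Fourier transforms of functions that are small in
`L¹` and of uniformly bounded variation. -/
lemma exists_forall_lintegral_fourierT_le {μ : Measure ℝ}
    (hμ : ∫⁻ z, ENNReal.ofReal ((1 + z ^ 2)⁻¹) ∂μ ≠ ∞) (K : ℝ) {ε : ℝ≥0∞} (hε : 0 < ε) :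
    ∃ η : ℝ, 0 < η ∧ ∀ g : ℝ → ℂ, (∫ y, ‖g y‖) ≤ η → (∀ z, |z| * ‖fourierT g z‖ ≤ K) →
      ∫⁻ z, ‖fourierT g z‖ₑ ^ 2 ∂μ ≤ ε := by
  -- An envelope independent of `g`: the first bound is `|ĝ| ≤ ‖g‖₁ ≤ 1/(n + 1)`, the second
  -- combines `|ĝ| ≤ 1` with `|z| |ĝ| ≤ K`. Dominated convergence then chooses `n`, and `η = 1/(n +
  -- 1)`, uniformly in `g`.
  set F : ℕ → ℝ → ℝ≥0∞ := fun n z ↦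
    ENNReal.ofReal (min (((n : ℝ) + 1)⁻¹ ^ 2) ((1 + K ^ 2) * (1 + z ^ 2)⁻¹)) with hF
  have hlim : Tendsto (fun n ↦ ∫⁻ z, F n z ∂μ) atTop (𝓝 (∫⁻ _, 0 ∂μ)) := by
    refine tendsto_lintegral_of_dominated_convergence
      (fun z ↦ ENNReal.ofReal (1 + K ^ 2) * ENNReal.ofReal ((1 + z ^ 2)⁻¹))
      (fun n ↦ by fun_prop) (fun n ↦ ae_of_all _ fun z ↦ ?_) ?_ (ae_of_all _ fun z ↦ ?_)
    · simp only [hF]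
      rw [← ENNReal.ofReal_mul (by positivity)]
      exact ENNReal.ofReal_le_ofReal (min_le_right _ _)
    · rw [lintegral_const_mul _ (by fun_prop)]
      exact ENNReal.mul_ne_top ENNReal.ofReal_ne_top hμ
    · have h0 : Tendsto (fun n : ℕ ↦ ((n : ℝ) + 1)⁻¹ ^ 2) atTop (𝓝 0) := by
        simpa using (tendsto_one_div_add_atTop_nhds_zero_nat (𝕜 := ℝ)).pow 2
      have h1 := h0.min (tendsto_const_nhds (x := (1 + K ^ 2) * (1 + z ^ 2)⁻¹))
      rw [min_eq_left (by positivity)] at h1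
      simpa only [ENNReal.ofReal_zero] using ENNReal.tendsto_ofReal h1
  rw [lintegral_zero] at hlim
  obtain ⟨n, hn⟩ := (hlim.eventually_lt_const hε).exists
  refine ⟨((n : ℝ) + 1)⁻¹, by positivity, fun g hg hK ↦ le_trans (lintegral_mono fun z ↦ ?_) hn.le⟩
  have h1 := (norm_fourierT_le g z).trans hg
  have h2 : ((n : ℝ) + 1)⁻¹ ≤ 1 := inv_le_one_of_one_le₀ (by linarith [(n.cast_nonneg : (0:ℝ) ≤ n)])
  rw [hF, ← ofReal_norm, ← ENNReal.ofReal_pow (norm_nonneg _)]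
  refine ENNReal.ofReal_le_ofReal (le_min (by gcongr) ?_)
  rw [← div_eq_mul_inv, le_div_iff₀ (by positivity)]
  have h3 : ‖fourierT g z‖ ^ 2 ≤ 1 := pow_le_one₀ (norm_nonneg _) (h1.trans h2)
  have h4 : (|z| * ‖fourierT g z‖) ^ 2 ≤ K ^ 2 := by gcongr; exact hK z
  rw [mul_pow, sq_abs] at h4
  linarith

lemma integrable_abs_rpow_mul {H : ℝ} (hH0 : 0 < H) (hH1 : H < 1) :
    Integrable fun z : ℝ ↦ (1 + z ^ 2)⁻¹ * |z| ^ (1 - 2 * H) := by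
  have hG1 := Real.Gamma_pos_of_pos hH0
  have hG2 := Real.Gamma_pos_of_pos (show 0 < 1 - H by linarith)
  -- The weight `|z|^{1 - 2H}` is `|z|^{2(1 - H) - 1}`, so the earlier integral applies with `1 - H`
  -- in place of `H`.
  have h := lintegral_rpow_div_one_add_sq (show 0 < 1 - H by linarith) (by linarith)
  refine .of_integral_ne_zero ?_
  have e : ∀ z : ℝ, (1 + z ^ 2)⁻¹ * |z| ^ (1 - 2 * H) =
      (fun u : ℝ ↦ u ^ (2 * (1 - H) - 1) * (1 / (1 + u ^ 2))) |z| := fun z ↦ by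
    simp only [sq_abs]
    ring_nf
  rw [integral_congr_ae (ae_of_all _ e), integral_comp_abs
    (f := fun u : ℝ ↦ u ^ (2 * (1 - H) - 1) * (1 / (1 + u ^ 2))),
    integral_eq_lintegral_of_nonneg_ae, h, sub_sub_cancel, ENNReal.toReal_ofReal (by positivity)]
  · positivity
  · filter_upwards [ae_restrict_mem measurableSet_Ioi] with z hz
    have : (0 : ℝ) < z := hz
    positivity
  · exact Measurable.aestronglyMeasurable (by fun_prop)

lemma lintegral_specMeasure_ne_top {H : ℝ} (hH0 : 0 < H) (hH1 : H < 1) :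
    ∫⁻ z, ENNReal.ofReal ((1 + z ^ 2)⁻¹) ∂(specMeasure H) ≠ ∞ := by
  rw [specMeasure, lintegral_withDensity_eq_lintegral_mul _ (by fun_prop) (by fun_prop)]
  refine ne_of_eq_of_ne (lintegral_congr fun z ↦ ?_)
    (integrable_abs_rpow_mul hH0 hH1).lintegral_lt_top.ne
  rw [Pi.mul_apply, mul_comm, ENNReal.ofReal_mul (by positivity)]

/-- The weight `(1 + ζ²)^γ dζ`. -/
def sobolevMeasure (γ : ℝ) : Measure ℝ :=
  volume.withDensity fun z ↦ ENNReal.ofReal ((1 + z ^ 2) ^ γ)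

lemma sobolevSq_eq {γ : ℝ} {f : ℝ → ℂ} (hf : Integrable f) :
    sobolevSq γ f = ∫⁻ z, ‖fourierT f z‖ₑ ^ 2 ∂(sobolevMeasure γ) := by
  have := (continuous_fourierT hf).measurable
  rw [sobolevMeasure, lintegral_withDensity_eq_lintegral_mul _ (by fun_prop) (by fun_prop)]
  rfl

lemma lintegral_sobolevMeasure_ne_top {γ : ℝ} (hγ : γ < 1 / 2) :
    ∫⁻ z, ENNReal.ofReal ((1 + z ^ 2)⁻¹) ∂(sobolevMeasure γ) ≠ ∞ := by
  rw [sobolevMeasure, lintegral_withDensity_eq_lintegral_mul _ (by fun_prop) (by fun_prop)]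
  have h := integrable_rpow_neg_one_add_norm_sq (E := ℝ) (μ := volume) (r := 2 - 2 * γ)
    (by simp; linarith)
  refine ne_of_eq_of_ne (lintegral_congr fun z ↦ ?_) h.lintegral_lt_top.ne
  rw [Pi.mul_apply, ← ENNReal.ofReal_mul (by positivity), ← Real.rpow_neg_one,
    ← Real.rpow_add (by positivity), Real.norm_eq_abs, sq_abs]
  ring_nf

/-! ### Step functions on partitions, summation by parts and bounded variation. -/

lemma sum_mul_sub_eq (c e : ℕ → ℂ) (N : ℕ) :
    ∑ k ∈ Finset.range (N + 1), c k * (e k - e (k + 1)) =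
      c 0 * e 0 + ∑ k ∈ Finset.range N, (c (k + 1) - c k) * e (k + 1) - c N * e (N + 1) := by
  induction N with
  | zero => simp; ring
  | succ N ih => rw [Finset.sum_range_succ, ih, Finset.sum_range_succ]; ring

/-- The step function `∑_{k < N} cₖ 1_{(tₖ, tₖ₊₁]}` on a partition. -/
def partStep (N : ℕ) (t : ℕ → ℝ) (c : ℕ → ℂ) : ℝ → ℂ :=
  stepFun (fun k : Fin N ↦ t k) (fun k : Fin N ↦ t (k + 1)) fun k ↦ c k

lemma partStep_apply (N : ℕ) (t : ℕ → ℝ) (c : ℕ → ℂ) (y : ℝ) :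
    partStep N t c y =
      ∑ k ∈ Finset.range N, indicator (Ioc (t k) (t (k + 1))) (fun _ ↦ c k) y :=
  Fin.sum_univ_eq_sum_range (fun k ↦ indicator (Ioc (t k) (t (k + 1))) (fun _ ↦ c k) y) N

lemma integrable_partStep (N : ℕ) (t : ℕ → ℝ) (c : ℕ → ℂ) : Integrable (partStep N t c) :=
  integrable_stepFun _ _ _

lemma partStep_eq {t : ℕ → ℝ} (ht : Monotone t) (c : ℕ → ℂ) (N : ℕ) (y : ℝ) :
    (y ∉ Ioc (t 0) (t N) ∧ partStep N t c y = 0) ∨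
      ∃ k < N, y ∈ Ioc (t k) (t (k + 1)) ∧ partStep N t c y = c k := by
  simp_rw [partStep_apply]
  induction N with
  | zero => simp
  | succ N ih =>
    rw [Finset.sum_range_succ]
    by_cases hy : y ∈ Ioc (t N) (t (N + 1))
    · refine Or.inr ⟨N, Nat.lt_succ_self N, hy, ?_⟩
      rw [indicator_of_mem hy]
      rcases ih with ⟨-, h⟩ | ⟨k, hk, hyk, -⟩
      · rw [h, zero_add]
      · exact absurd (hyk.2.trans (ht hk)) (not_le.2 hy.1)
    · rw [indicator_of_notMem hy, add_zero]
      rcases ih with ⟨h0, h⟩ | ⟨k, hk, h⟩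
      · refine Or.inl ⟨fun h' ↦ ?_, h⟩
        rcases le_or_gt y (t N) with h1 | h1
        · exact h0 ⟨h'.1, h1⟩
        · exact hy ⟨h1, h'.2⟩
      · exact Or.inr ⟨k, hk.trans (Nat.lt_succ_self N), h⟩

/-- Summation by parts writes `i z φ̂(z)` as a sum of jumps times unimodular factors: the two outer
jumps cost `2 * M`, the inner ones at most `V`. The `N` cells have only `N - 1` inner jumps, whence
the condition `n + 1 ≤ N`. -/
lemma abs_mul_norm_fourierT_partStep_le {t : ℕ → ℝ} (ht : Monotone t) (c : ℕ → ℂ) (N : ℕ)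
    {M V : ℝ} (hV0 : 0 ≤ V) (hM : ∀ k, ‖c k‖ ≤ M)
    (hV : ∀ n, n + 1 ≤ N → ∑ k ∈ Finset.range n, ‖c (k + 1) - c k‖ ≤ V) (z : ℝ) :
    |z| * ‖fourierT (partStep N t c) z‖ ≤ 2 * M + V := by
  rcases N with _ | N
  · have h0 : partStep 0 t c = 0 := by ext; simp [partStep_apply]
    have hM0 := (norm_nonneg _).trans (hM 0)
    simp only [h0, fourierT, Pi.zero_apply, zero_mul, integral_zero, norm_zero, mul_zero]
    positivity
  have h := mul_fourierT_stepFun (a := fun k : Fin (N + 1) ↦ t k)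
    (b := fun k : Fin (N + 1) ↦ t (k + 1)) (fun k ↦ ht (Nat.le_succ _)) (fun k ↦ c k) z
  set e : ℕ → ℂ := fun k ↦ Complex.exp (-(Complex.I * z * t k)) with he
  have hn : ∀ k, ‖e k‖ = 1 := fun k ↦ norm_exp_neg_I_mul z (t k)
  rw [Fin.sum_univ_eq_sum_range (fun k ↦ c k * (e k - e (k + 1))) (N + 1), sum_mul_sub_eq] at h
  have h' := congrArg norm h
  rw [norm_mul, norm_mul, Complex.norm_I, one_mul, Complex.norm_real, Real.norm_eq_abs] at h'
  change |z| * ‖fourierT (stepFun _ _ _) z‖ ≤ _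
  rw [h']
  calc _ ≤ ‖c 0 * e 0‖ + ∑ k ∈ Finset.range N, ‖(c (k + 1) - c k) * e (k + 1)‖
        + ‖c N * e (N + 1)‖ :=
        (norm_sub_le _ _).trans (add_le_add_left ((norm_add_le _ _).trans
          (add_le_add_right (norm_sum_le _ _) _)) _)
    _ ≤ M + V + M := by
        simp only [norm_mul, hn, mul_one]
        exact add_le_add (add_le_add (hM 0) (hV N le_rfl)) (hM N)
    _ = _ := by ring

/-- A bounded Lipschitz function that is constant to the left and to the right of `[a, b]`. -/
structure IsClampLipschitz (g : ℝ → ℂ) (a b M : ℝ) (L : ℝ≥0) : Prop where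
  le : a ≤ b
  lipschitz : LipschitzWith L g
  clamp : ∀ y, g y = g (max a (min b y))
  bound : ∀ y, ‖g y‖ ≤ M

/-- The points may leave `[a, b]`; clamping them is monotone and does not change `g`, so the
increments telescope to at most `b - a` whatever the number of points. -/
lemma IsClampLipschitz.sum_norm_sub_le {g : ℝ → ℂ} {a b M : ℝ} {L : ℝ≥0}
    (hg : IsClampLipschitz g a b M L) {τ : ℕ → ℝ} {n : ℕ} (hτ : ∀ k < n, τ k ≤ τ (k + 1)) :
    ∑ k ∈ Finset.range n, ‖g (τ (k + 1)) - g (τ k)‖ ≤ L * (b - a) := by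
  set q : ℝ → ℝ := fun y ↦ max a (min b y) with hq
  calc _ ≤ ∑ k ∈ Finset.range n, L * (q (τ (k + 1)) - q (τ k)) := by
        refine Finset.sum_le_sum fun k hk ↦ ?_
        have hmono : q (τ k) ≤ q (τ (k + 1)) :=
          max_le_max le_rfl (min_le_min le_rfl (hτ k (Finset.mem_range.1 hk)))
        rw [hg.clamp (τ (k + 1)), hg.clamp (τ k)]
        refine (hg.lipschitz.norm_sub_le _ _).trans_eq ?_
        rw [Real.norm_of_nonneg (sub_nonneg.2 hmono)]
    _ = L * (q (τ n) - q (τ 0)) := by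
        rw [← Finset.mul_sum, Finset.sum_range_sub (fun k ↦ q (τ k))]
    _ ≤ _ := by
        gcongr
        · exact max_le hg.le (min_le_left _ _)
        · exact le_max_left _ _

lemma IsClampLipschitz.abs_mul_norm_fourierT_le {g : ℝ → ℂ} {a b M : ℝ} {L : ℝ≥0}
    (hg : IsClampLipschitz g a b M L) {N : ℕ} {t τ : ℕ → ℝ} (ht : Monotone t)
    (hτ : ∀ k < N, τ k ∈ Icc (t k) (t (k + 1))) (z : ℝ) :
    |z| * ‖fourierT (partStep N t fun k ↦ g (τ k)) z‖ ≤ 2 * M + L * (b - a) := by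
  refine abs_mul_norm_fourierT_partStep_le ht _ N
    (mul_nonneg L.2 (sub_nonneg.2 hg.le)) (fun k ↦ hg.bound _) (fun n hn ↦ ?_) z
  exact hg.sum_norm_sub_le fun k hk ↦ (hτ k (by omega)).2.trans (hτ (k + 1) (by omega)).1

lemma IsClampLipschitz.norm_partStep_sub_le {g : ℝ → ℂ} {a b M : ℝ} {L : ℝ≥0}
    (hg : IsClampLipschitz g a b M L) {N : ℕ} {t τ : ℕ → ℝ} (ht : Monotone t) {δ : ℝ}
    (hτ : ∀ k < N, τ k ∈ Icc (t k) (t (k + 1)) ∧ t (k + 1) - t k ≤ δ) (y : ℝ) :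
    (y ∉ Ioc (t 0) (t N) ∧ partStep N t (fun k ↦ g (τ k)) y = 0) ∨
      ‖partStep N t (fun k ↦ g (τ k)) y - g y‖ ≤ L * δ := by
  rcases partStep_eq ht (fun k ↦ g (τ k)) N y with h | ⟨k, hk, hy, h⟩
  · exact Or.inl h
  · refine Or.inr ?_
    rw [h]
    refine (hg.lipschitz.norm_sub_le _ _).trans ?_
    obtain ⟨⟨h1, h2⟩, h3⟩ := hτ k hk
    gcongr
    rw [Real.norm_eq_abs, abs_le]
    constructor <;> linarith [hy.1, hy.2]

/-- `L¹` convergence gives pointwise convergence of the transforms, so a common decay constant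
survives in the limit. -/
lemma abs_mul_norm_fourierT_le_of_approx {f : ℝ → ℂ} (hf : Integrable f) {K : ℝ}
    (h : ∀ η : ℝ, 0 < η → ∃ ψ : ℝ → ℂ, Integrable ψ ∧ (∫ y, ‖(ψ - f) y‖) ≤ η ∧
      ∀ z, |z| * ‖fourierT ψ z‖ ≤ K) (z : ℝ) : |z| * ‖fourierT f z‖ ≤ K := by
  refine le_of_forall_pos_le_add fun ε hε ↦ ?_
  obtain ⟨ψ, hψ, h1, h2⟩ := h (ε / (|z| + 1)) (by positivity)
  have h3 := (norm_fourierT_le (ψ - f) z).trans h1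
  rw [fourierT_sub hψ hf, Pi.sub_apply] at h3
  have h4 : ‖fourierT f z‖ ≤ ‖fourierT ψ z‖ + ε / (|z| + 1) := by
    have := norm_sub_norm_le (fourierT f z) (fourierT ψ z)
    rw [norm_sub_rev] at this
    linarith
  calc _ ≤ |z| * (‖fourierT ψ z‖ + ε / (|z| + 1)) := by gcongr
    _ = |z| * ‖fourierT ψ z‖ + ε * (|z| / (|z| + 1)) := by ring
    _ ≤ K + ε * 1 := by
        gcongr
        · exact h2 z
        · exact (div_le_one (by positivity)).2 (by linarith)
    _ = _ := by ring

lemma abs_mul_norm_fourierT_sub_le {f g : ℝ → ℂ} (hf : Integrable f) (hg : Integrable g)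
    {K K' : ℝ} (h : ∀ z, |z| * ‖fourierT f z‖ ≤ K) (h' : ∀ z, |z| * ‖fourierT g z‖ ≤ K') (z : ℝ) :
    |z| * ‖fourierT (f - g) z‖ ≤ K + K' := by
  rw [fourierT_sub hf hg, Pi.sub_apply]
  calc _ ≤ |z| * (‖fourierT f z‖ + ‖fourierT g z‖) := by gcongr; exact norm_sub_le _ _
    _ ≤ _ := by rw [mul_add]; exact add_le_add (h z) (h' z)

lemma tendsto_lintegral_fourierT_sub {μ : Measure ℝ}
    (hμ : ∫⁻ z, ENNReal.ofReal ((1 + z ^ 2)⁻¹) ∂μ ≠ ∞) {φ : ℕ → ℝ → ℂ} {f : ℝ → ℂ} {K : ℝ}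
    (h1 : Tendsto (fun n ↦ ∫ y, ‖(φ n - f) y‖) atTop (𝓝 0))
    (hK : ∀ n z, |z| * ‖fourierT (φ n - f) z‖ ≤ K) :
    Tendsto (fun n ↦ ∫⁻ z, ‖fourierT (φ n - f) z‖ₑ ^ 2 ∂μ) atTop (𝓝 0) := by
  rw [ENNReal.tendsto_nhds_zero]
  intro ε hε
  obtain ⟨η, hη, h⟩ := exists_forall_lintegral_fourierT_le hμ K hε
  filter_upwards [h1.eventually_le_const hη] with n hn
  exact h _ hn (hK n)

/-- One criterion for all three modes: the decay bound handles the Sobolev weight, since `1/2 - H <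
1/2`, and the sup bound gives `‖·‖₂² ≤ M ‖·‖₁`. -/
lemma integrandTendsto_of_bounded_variation {H : ℝ} (hH0 : 0 < H) {φ : ℕ → ℝ → ℂ} {f : ℝ → ℂ}
    (hφ : ∀ n, Integrable (φ n)) (hf : Integrable f) {K M : ℝ}
    (h1 : Tendsto (fun n ↦ ∫ y, ‖(φ n - f) y‖) atTop (𝓝 0))
    (hK : ∀ n z, |z| * ‖fourierT (φ n - f) z‖ ≤ K) (hM : ∀ n y, ‖(φ n - f) y‖ ≤ M) :
    IntegrandTendsto H φ f := by
  have hL1 : Tendsto (fun n ↦ eLpNorm (φ n - f) 1 volume) atTop (𝓝 0) := by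
    simp_rw [eLpNorm_one_eq_lintegral_enorm]
    have := ENNReal.tendsto_ofReal h1
    rw [ENNReal.ofReal_zero] at this
    refine this.congr fun n ↦ ?_
    exact ofReal_integral_norm_eq_lintegral_enorm ((hφ n).sub hf)
  refine ⟨fun h ↦ ?_, fun _ ↦ ?_, fun _ ↦ hL1⟩
  · simp_rw [fun n ↦ sobolevSq_eq (γ := 1 / 2 - H) ((hφ n).sub hf)]
    exact tendsto_lintegral_fourierT_sub (lintegral_sobolevMeasure_ne_top (by linarith)) h1 hK
  · refine tendsto_ennreal_zero_of_sq ?_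
    have h2 : Tendsto (fun n ↦ ENNReal.ofReal M * eLpNorm (φ n - f) 1 volume) atTop (𝓝 0) := by
      simpa using ENNReal.Tendsto.const_mul hL1 (Or.inr ENNReal.ofReal_ne_top)
    refine tendsto_of_tendsto_of_tendsto_of_le_of_le tendsto_const_nhds h2 (fun _ ↦ zero_le)
      fun n ↦ ?_
    simp only
    rw [eLpNorm_two_sq, eLpNorm_one_eq_lintegral_enorm,
      ← lintegral_const_mul' _ _ ENNReal.ofReal_ne_top]
    refine lintegral_mono fun y ↦ ?_
    rw [sq]
    gcongr
    rw [← ofReal_norm]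
    exact ENNReal.ofReal_le_ofReal (hM n y)

lemma isStepIntegral_partStep {Ω : Type*} (B : ℝ → Ω → ℝ) {t : ℕ → ℝ} (ht : Monotone t) (c : ℕ → ℂ) (N : ℕ) :
    IsStepIntegral B (partStep N t c) fun ϖ ↦ ∑ k ∈ Finset.range N,
      c k * ((B (t (k + 1)) ϖ - B (t k) ϖ : ℝ) : ℂ) :=
  ⟨N, fun k ↦ t k, fun k ↦ t (k + 1), fun k ↦ c k, fun _ ↦ ht (Nat.le_succ _), rfl,
    funext fun ϖ ↦ (Fin.sum_univ_eq_sum_range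
      (fun k ↦ c k * ((B (t (k + 1)) ϖ - B (t k) ϖ : ℝ) : ℂ)) N).symm⟩

/-! ### Riemann–Stieltjes integrals of test functions. -/

section TestIntegral

variable {Ω : Type*} [MeasurableSpace Ω] {P : Measure Ω} {H : ℝ} {B : ℝ → Ω → ℝ}

/-- Tagged partitions of an interval containing the support of `φ`, of mesh at most `δ`. -/
def IsTaggedPartition (φ : ℝ → ℂ) (δ : ℝ) (N : ℕ) (t τ : ℕ → ℝ) : Prop :=
  Monotone t ∧ Function.support φ ⊆ Icc (t 0) (t N) ∧
    ∀ k < N, τ k ∈ Icc (t k) (t (k + 1)) ∧ t (k + 1) - t k ≤ δ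

lemma exists_isTaggedPartition {φ : ℝ → ℂ} {R : ℝ} (hR : Function.support φ ⊆ Icc (-R) R)
    {δ : ℝ} (hδ : 0 < δ) : ∃ N t τ, IsTaggedPartition φ δ N t τ := by
  refine ⟨⌈2 * R / δ⌉₊, fun k ↦ -R + k * δ, fun k ↦ -R + k * δ, fun i j hij ↦ ?_, ?_,
    fun k _ ↦ ⟨⟨le_rfl, ?_⟩, ?_⟩⟩
  · simp only
    gcongr
  · refine hR.trans (Icc_subset_Icc (by simp) ?_)
    have := (div_le_iff₀ hδ).1 (Nat.le_ceil (2 * R / δ))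
    linarith
  · push_cast; nlinarith
  · push_cast; linarith

lemma exists_isClampLipschitz {φ : ℝ → ℂ} (hφ : ContDiff ℝ ((⊤ : ℕ∞) : WithTop ℕ∞) φ)
    (hc : HasCompactSupport φ) : ∃ (R M : ℝ) (L : ℝ≥0), 0 < R ∧
      Function.support φ ⊆ Icc (-R) R ∧ IsClampLipschitz φ (-R) R M L := by
  obtain ⟨L, hL⟩ := hφ.lipschitzWith_of_hasCompactSupport hc (by simp)
  obtain ⟨M, hM⟩ := hc.exists_bound_of_continuous hφ.continuous
  obtain ⟨R, hR⟩ := hc.isBounded.subset_closedBall 0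
  have hz : ∀ y, R < |y| → φ y = 0 := fun y hy ↦ by
    by_contra h
    have := hR (subset_tsupport φ h)
    rw [mem_closedBall_zero_iff, Real.norm_eq_abs] at this
    linarith
  -- The radius is enlarged so that `φ` vanishes at the endpoints themselves, which makes clamping
  -- harmless.
  refine ⟨|R| + 1, M, L, by positivity, fun y hy ↦ ?_, by linarith [abs_nonneg R], hL,
    fun y ↦ ?_, hM⟩
  · by_contra h
    refine hy (hz y ?_)
    by_contra h'
    push Not at h'
    exact h (abs_le.1 (h'.trans ((le_abs_self R).trans (by linarith))))
  · have hR1 : R < |R| + 1 := (le_abs_self R).trans_lt (by linarith)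
    have hR0 := abs_nonneg R
    rcases le_total y (-(|R| + 1)) with h | h
    · rw [min_eq_right (by linarith), max_eq_left h, hz y (by rw [abs_of_nonpos] <;> linarith),
        hz _ (by rw [abs_neg, abs_of_pos] <;> linarith)]
    rcases le_total y (|R| + 1) with h' | h'
    · rw [min_eq_right h', max_eq_right h]
    · rw [min_eq_left h', max_eq_right (by linarith), hz y (by rw [abs_of_nonneg] <;> linarith),
        hz _ (by rw [abs_of_pos] <;> linarith)]

/-- The pointwise error is at most `L * δ`, and it vanishes outside `[-R - 1, R + 1]` because a cell
whose tag lies in the support has length at most `δ ≤ 1`. -/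
lemma integral_norm_partStep_sub_le {φ : ℝ → ℂ} {R M : ℝ} {L : ℝ≥0} (hR0 : 0 < R)
    (hR : Function.support φ ⊆ Icc (-R) R) (hφ : IsClampLipschitz φ (-R) R M L) {δ : ℝ}
    (hδ0 : 0 < δ) (hδ : δ ≤ 1) {N : ℕ} {t τ : ℕ → ℝ} (h : IsTaggedPartition φ δ N t τ) :
    ∫ y, ‖(partStep N t (fun k ↦ φ (τ k)) - φ) y‖ ≤ L * δ * (2 * R + 2) := by
  obtain ⟨ht, hs, hτ⟩ := h
  have hsupp : ∀ y, φ y ≠ 0 → y ∈ Ioc (t 0) (t N) := by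
    -- The support is open, hence misses the endpoints; the left endpoint excluded by half-open
    -- cells therefore does no harm.
    have : Function.support φ ⊆ interior (Icc (t 0) (t N)) :=
      interior_maximal hs (hφ.lipschitz.continuous.isOpen_support)
    rw [interior_Icc] at this
    exact fun y hy ↦ Ioo_subset_Ioc_self (this hy)
  have hle : ∀ y, ‖(partStep N t (fun k ↦ φ (τ k)) - φ) y‖ ≤
      indicator (Icc (-R - 1) (R + 1)) (fun _ ↦ (L : ℝ) * δ) y := by
    intro y
    rw [Pi.sub_apply]
    by_cases hy : y ∈ Icc (-R - 1) (R + 1)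
    · rw [indicator_of_mem hy]
      rcases hφ.norm_partStep_sub_le ht hτ y with ⟨h1, h2⟩ | h1
      · have : φ y = 0 := by
          by_contra h3
          exact h1 (hsupp y h3)
        rw [h2, this, sub_zero, norm_zero]
        positivity
      · exact h1
    · rw [indicator_of_notMem hy]
      have h0 : φ y = 0 := by
        by_contra h3
        have := hR h3
        exact hy ⟨by linarith [this.1], by linarith [this.2]⟩
      rcases partStep_eq ht (fun k ↦ φ (τ k)) N y with ⟨-, h1⟩ | ⟨k, hk, hyk, h1⟩
      · simp [h0, h1]
      · have h2 : φ (τ k) = 0 := by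
          by_contra h3
          have h4 := hR h3
          obtain ⟨⟨h5, h6⟩, h7⟩ := hτ k hk
          exact hy ⟨by linarith [h4.1, hyk.1, hyk.2], by linarith [h4.2, hyk.1, hyk.2]⟩
        simp [h0, h1, h2]
  calc _ ≤ ∫ y, indicator (Icc (-R - 1) (R + 1)) (fun _ ↦ (L : ℝ) * δ) y := by
        refine integral_mono_of_nonneg (ae_of_all _ fun y ↦ norm_nonneg _) ?_ (ae_of_all _ hle)
        exact (integrable_indicator_iff measurableSet_Icc).2 continuous_const.integrableOn_Icc
    _ = _ := by
        rw [integral_indicator measurableSet_Icc]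
        simp
        rw [max_eq_left (by linarith)]
        ring

lemma abs_mul_norm_fourierT_le_of_support_subset {φ : ℝ → ℂ} (hi : Integrable φ) {R M : ℝ} {L : ℝ≥0}
    (hR0 : 0 < R) (hR : Function.support φ ⊆ Icc (-R) R) (hφ : IsClampLipschitz φ (-R) R M L)
    (z : ℝ) : |z| * ‖fourierT φ z‖ ≤ 2 * M + L * (R - -R) := by
  refine abs_mul_norm_fourierT_le_of_approx hi (fun η hη ↦ ?_) z
  -- Chosen to make `L * δ * (2 * R + 2) ≤ η`; the extra `+ 1` keeps the denominator positive.
  set δ : ℝ := min 1 (η / (L * (2 * R + 2) + 1)) with hδ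
  have hδ0 : 0 < δ := lt_min one_pos (by positivity)
  obtain ⟨N, t, τ, h⟩ := exists_isTaggedPartition hR hδ0
  refine ⟨_, integrable_partStep N t fun k ↦ φ (τ k),
    (integral_norm_partStep_sub_le hR0 hR hφ hδ0 (min_le_left _ _) h).trans ?_,
    fun z ↦ hφ.abs_mul_norm_fourierT_le h.1 (fun k hk ↦ (h.2.2 k hk).1) z⟩
  have h1 : δ * (L * (2 * R + 2) + 1) ≤ η :=
    (le_div_iff₀ (by positivity)).1 (min_le_right _ _)
  nlinarith

lemma exists_eLpNorm_fourierT_partStep_le (hH0 : 0 < H) (hH1 : H < 1) {φ : ℝ → ℂ}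
    (hφ : ContDiff ℝ ((⊤ : ℕ∞) : WithTop ℕ∞) φ) (hc : HasCompactSupport φ) {ε : ℝ≥0∞}
    (hε : 0 < ε) : ∃ δ : ℝ, 0 < δ ∧ ∀ N t τ, IsTaggedPartition φ δ N t τ →
      eLpNorm (fourierT (partStep N t (fun k ↦ φ (τ k)) - φ)) 2 (specMeasure H) ≤ ε := by
  obtain ⟨R, M, L, hR0, hR, hL⟩ := exists_isClampLipschitz hφ hc
  have hi := hφ.continuous.integrable_of_hasCompactSupport hc (μ := volume)
  obtain ⟨η, hη, h⟩ := exists_forall_lintegral_fourierT_le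
    (lintegral_specMeasure_ne_top hH0 hH1) (2 * M + L * (R - -R) + (2 * M + L * (R - -R)))
    (ENNReal.pow_pos hε 2)
  refine ⟨min 1 (η / (L * (2 * R + 2) + 1)), lt_min one_pos (by positivity),
    fun N t τ hp ↦ ?_⟩
  set δ : ℝ := min 1 (η / (L * (2 * R + 2) + 1)) with hδ
  have hδ0 : 0 < δ := lt_min one_pos (by positivity)
  have h1 : δ * (L * (2 * R + 2) + 1) ≤ η :=
    (le_div_iff₀ (by positivity)).1 (min_le_right _ _)
  refine (ENNReal.pow_right_strictMono two_ne_zero).le_iff_le.1 ?_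
  rw [eLpNorm_two_sq]
  refine h _ ((integral_norm_partStep_sub_le hR0 hR hL hδ0 (min_le_left _ _) hp).trans ?_)
    (abs_mul_norm_fourierT_sub_le (integrable_partStep _ _ _) hi
      (fun z ↦ hL.abs_mul_norm_fourierT_le hp.1 (fun k hk ↦ (hp.2.2 k hk).1) z)
      (abs_mul_norm_fourierT_le_of_support_subset hi hR0 hR hL))
  nlinarith

lemma IsTestIntegral.integrable {φ : ℝ → ℂ} {Y : Ω → ℂ} (h : IsTestIntegral P B φ Y) :
    Integrable φ :=
  h.1.continuous.integrable_of_hasCompactSupport h.2.1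

lemma IsTestIntegral.memLp_fun {φ : ℝ → ℂ} {Y : Ω → ℂ} (h : IsTestIntegral P B φ Y) :
    MemLp φ 2 :=
  h.1.continuous.memLp_of_hasCompactSupport h.2.1

lemma IsTaggedPartition.mono {φ : ℝ → ℂ} {δ δ' : ℝ} {N : ℕ} {t τ : ℕ → ℝ}
    (h : IsTaggedPartition φ δ N t τ) (hδ : δ ≤ δ') : IsTaggedPartition φ δ' N t τ :=
  ⟨h.1, h.2.1, fun k hk ↦ ⟨(h.2.2 k hk).1, (h.2.2 k hk).2.trans hδ⟩⟩

lemma tendsto_ofReal_inv_add_one :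
    Tendsto (fun n : ℕ ↦ ENNReal.ofReal ((n : ℝ) + 1)⁻¹) atTop (𝓝 0) := by
  simpa using ENNReal.tendsto_ofReal (tendsto_one_div_add_atTop_nhds_zero_nat (𝕜 := ℝ))

/-- A partition fine enough for both purposes makes the Riemann–Stieltjes sum close to `Y` and its
step integrand close to `φ` in the spectral norm. -/
lemma IsTestIntegral.isSpectralIntegral (hH0 : 0 < H) (hH1 : H < 1) {φ : ℝ → ℂ} {Y : Ω → ℂ}
    (h : IsTestIntegral P B φ Y) : IsSpectralIntegral P H B φ Y := by
  have hi := h.integrable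
  obtain ⟨hφ, hc, hY, hlim⟩ := h
  obtain ⟨R, M, L, hR0, hR, hL⟩ := exists_isClampLipschitz hφ hc
  have key : ∀ m : ℕ, ∃ ψ Z, IsStepIntegral B ψ Z ∧
      eLpNorm (Z - Y) 2 P ≤ ENNReal.ofReal ((m : ℝ) + 1)⁻¹ ∧
      eLpNorm (fourierT (ψ - φ)) 2 (specMeasure H) ≤ ENNReal.ofReal ((m : ℝ) + 1)⁻¹ := by
    intro m
    obtain ⟨δ, hδ, h1⟩ := hlim ((m : ℝ) + 1)⁻¹ (by positivity)
    obtain ⟨δ', hδ', h2⟩ := exists_eLpNorm_fourierT_partStep_le hH0 hH1 hφ hc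
      (ε := ENNReal.ofReal ((m : ℝ) + 1)⁻¹) (by simp; positivity)
    obtain ⟨N, t, τ, hp⟩ := exists_isTaggedPartition hR (lt_min hδ hδ')
    have hp1 := hp.mono (min_le_left _ _)
    refine ⟨_, _, isStepIntegral_partStep B hp.1 (fun k ↦ φ (τ k)) N, ?_,
      h2 N t τ (hp.mono (min_le_right _ _))⟩
    rw [eLpNorm_sub_comm]
    exact h1 N t τ hp1.1 hp1.2.1 hp1.2.2
  choose ψ Z hs h1 h2 using key
  exact ⟨hi, hY, ψ, Z, hs,
    tendsto_of_tendsto_of_tendsto_of_le_of_le tendsto_const_nhds tendsto_ofReal_inv_add_one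
      (fun _ ↦ zero_le) h1,
    tendsto_of_tendsto_of_tendsto_of_le_of_le tendsto_const_nhds tendsto_ofReal_inv_add_one
      (fun _ ↦ zero_le) h2⟩

/-- The spectral integral serves as `Y`: by the isometry its distance to any Riemann–Stieltjes sum
is `C_H` times the spectral error of the step integrand, which is small uniformly over fine
partitions. -/
lemma exists_isTestIntegral (hB : IsFBM P H B) (hH0 : 0 < H) (hH1 : H < 1) {φ : ℝ → ℂ}
    (hφ : ContDiff ℝ ((⊤ : ℕ∞) : WithTop ℕ∞) φ) (hc : HasCompactSupport φ) :
    ∃ Y, IsTestIntegral P B φ Y := by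
  obtain ⟨R, M, L, hR0, hR, hL⟩ := exists_isClampLipschitz hφ hc
  have hi := hφ.continuous.integrable_of_hasCompactSupport hc (μ := volume)
  have key : ∀ m : ℕ, ∃ ψ Z, IsStepIntegral B ψ Z ∧
      eLpNorm (fourierT (ψ - φ)) 2 (specMeasure H) ≤ ENNReal.ofReal ((m : ℝ) + 1)⁻¹ := by
    intro m
    obtain ⟨δ', hδ', h2⟩ := exists_eLpNorm_fourierT_partStep_le hH0 hH1 hφ hc
      (ε := ENNReal.ofReal ((m : ℝ) + 1)⁻¹) (by simp; positivity)
    obtain ⟨N, t, τ, hp⟩ := exists_isTaggedPartition hR hδ'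
    exact ⟨_, _, isStepIntegral_partStep B hp.1 (fun k ↦ φ (τ k)) N, h2 N t τ hp⟩
  choose ψ Z hs h2 using key
  obtain ⟨Y, hY⟩ := exists_isSpectralIntegral hB hH0 hH1 hi hs
    (tendsto_of_tendsto_of_tendsto_of_le_of_le tendsto_const_nhds tendsto_ofReal_inv_add_one
      (fun _ ↦ zero_le) h2)
  refine ⟨Y, hφ, hc, hY.2.1, fun ε hε ↦ ?_⟩
  have hC := CH_pos hH0 hH1
  obtain ⟨δ, hδ, h⟩ := exists_eLpNorm_fourierT_partStep_le hH0 hH1 hφ hc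
      (ε := ENNReal.ofReal (ε / CH H)) (by simp; positivity)
  refine ⟨δ, hδ, fun N t τ ht hsup hτ ↦ ?_⟩
  have hs := (isStepIntegral_partStep B ht (fun k ↦ φ (τ k)) N).isSpectralIntegral hB
  have h3 := hs.eLpNorm_sub hB hH0 hH1 hY
  rw [eLpNorm_sub_comm] at h3
  refine h3.le.trans ?_
  calc _ ≤ ENNReal.ofReal (CH H) * ENNReal.ofReal (ε / CH H) := by
        gcongr
        exact h N t τ ⟨ht, hsup, hτ⟩
    _ = _ := by
        rw [← ENNReal.ofReal_mul hC.le]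
        congr 1
        field_simp

end TestIntegral

/-! ### The prescribed convergence of integrands controls the spectral norm. -/

lemma lintegral_specMeasure_le_sobolevSq {H : ℝ} (hH : H ≤ 1 / 2) {g : ℝ → ℂ}
    (hg : Integrable g) :
    ∫⁻ z, ‖fourierT g z‖ₑ ^ 2 ∂(specMeasure H) ≤ sobolevSq (1 / 2 - H) g := by
  rw [lintegral_specMeasure (continuous_fourierT hg).measurable, sobolevSq]
  refine lintegral_mono fun z ↦ ?_
  rw [mul_comm, ENNReal.ofReal_mul (by positivity), ENNReal.ofReal_pow (norm_nonneg _), ofReal_norm]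
  gcongr
  rw [show 1 - 2 * H = 2 * (1 / 2 - H) by ring, Real.rpow_mul (abs_nonneg z)]
  refine Real.rpow_le_rpow (by positivity) ?_ (by linarith)
  rw [Real.rpow_two, sq_abs]
  linarith

lemma lintegral_specMeasure_half {g : ℝ → ℂ} (hg : Integrable g) (hg2 : MemLp g 2) :
    ∫⁻ z, ‖fourierT g z‖ₑ ^ 2 ∂(specMeasure (1 / 2)) =
      ENNReal.ofReal (2 * Real.pi) * eLpNorm g 2 volume ^ 2 := by
  rw [eLpNorm_two_sq, ← lintegral_enorm_fourierT_sq hg hg2]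
  simp [specMeasure]

/-- For `|z| ≤ 1` the weight is singular but integrable and `|ĝ| ≤ ‖g‖₁`; for `|z| > 1` the weight
is at most `1` and Plancherel applies. This is why both norms are needed when `H > 1/2`. -/
lemma lintegral_specMeasure_le_of_half_lt {H : ℝ} (hH : 1 / 2 < H) {g : ℝ → ℂ}
    (hg : Integrable g) (hg2 : MemLp g 2) :
    ∫⁻ z, ‖fourierT g z‖ₑ ^ 2 ∂(specMeasure H) ≤
      2 * (∫⁻ z, ENNReal.ofReal ((1 + z ^ 2)⁻¹) ∂(specMeasure H)) * eLpNorm g 1 volume ^ 2 +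
        ENNReal.ofReal (2 * Real.pi) * eLpNorm g 2 volume ^ 2 := by
  have hm := (continuous_fourierT hg).measurable
  rw [eLpNorm_two_sq, ← lintegral_enorm_fourierT_sq hg hg2, specMeasure,
    lintegral_withDensity_eq_lintegral_mul _ (by fun_prop) (by fun_prop),
    lintegral_withDensity_eq_lintegral_mul _ (by fun_prop) (by fun_prop),
    ← lintegral_const_mul _ (by fun_prop), ← lintegral_mul_const _ (by fun_prop),
    ← lintegral_add_right _ (by fun_prop)]
  refine lintegral_mono fun z ↦ ?_
  simp only [Pi.mul_apply]
  rcases le_or_gt |z| 1 with hz | hz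
  · refine le_add_right ?_
    have h1 : ‖fourierT g z‖ₑ ≤ eLpNorm g 1 volume := by
      rw [eLpNorm_one_eq_lintegral_enorm, ← ofReal_integral_norm_eq_lintegral_enorm hg,
        ← ofReal_norm]
      exact ENNReal.ofReal_le_ofReal (norm_fourierT_le g z)
    have h2 : (1 : ℝ≥0∞) ≤ 2 * ENNReal.ofReal ((1 + z ^ 2)⁻¹) := by
      rw [← ENNReal.ofReal_ofNat 2, ← ENNReal.ofReal_mul (by norm_num), ← ENNReal.ofReal_one]
      refine ENNReal.ofReal_le_ofReal ?_
      rw [← div_eq_mul_inv, le_div_iff₀ (by positivity)]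
      have := pow_le_one₀ (abs_nonneg z) hz (n := 2)
      rw [sq_abs] at this
      linarith
    calc _ ≤ ENNReal.ofReal (|z| ^ (1 - 2 * H)) * eLpNorm g 1 volume ^ 2 := by gcongr
      _ = 1 * (ENNReal.ofReal (|z| ^ (1 - 2 * H)) * eLpNorm g 1 volume ^ 2) := (one_mul _).symm
      _ ≤ (2 * ENNReal.ofReal ((1 + z ^ 2)⁻¹)) *
          (ENNReal.ofReal (|z| ^ (1 - 2 * H)) * eLpNorm g 1 volume ^ 2) := by gcongr
      _ = _ := by ring
  · refine le_add_left ?_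
    have h1 : ENNReal.ofReal (|z| ^ (1 - 2 * H)) ≤ 1 := by
      rw [← ENNReal.ofReal_one]
      exact ENNReal.ofReal_le_ofReal (Real.rpow_le_one_of_one_le_of_nonpos hz.le (by linarith))
    exact (mul_le_mul_left h1 _).trans_eq (one_mul _)

lemma IntegrandTendsto.tendsto_eLpNorm_fourierT {H : ℝ} (hH0 : 0 < H) (hH1 : H < 1)
    {φ : ℕ → ℝ → ℂ} {f : ℝ → ℂ} (h : IntegrandTendsto H φ f) (hφ : ∀ n, Integrable (φ n))
    (hφ2 : ∀ n, MemLp (φ n) 2) (hf : Integrable f) (hf2 : MemLp f 2) :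
    Tendsto (fun n ↦ eLpNorm (fourierT (φ n - f)) 2 (specMeasure H)) atTop (𝓝 0) := by
  refine tendsto_ennreal_zero_of_sq ?_
  simp_rw [eLpNorm_two_sq]
  have hpi : ENNReal.ofReal (2 * Real.pi) ≠ ∞ := ENNReal.ofReal_ne_top
  have hsq : ∀ {u : ℕ → ℝ≥0∞} {c : ℝ≥0∞}, c ≠ ∞ → Tendsto u atTop (𝓝 0) →
      Tendsto (fun n ↦ c * u n ^ 2) atTop (𝓝 0) := fun {u c} hc hu ↦ by
    have := ENNReal.Tendsto.const_mul (ENNReal.Tendsto.pow (n := 2) hu) (Or.inr hc)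
    simpa using this
  rcases lt_trichotomy H (1 / 2) with hH | rfl | hH
  · exact tendsto_of_tendsto_of_tendsto_of_le_of_le tendsto_const_nhds (h.1 hH)
      (fun _ ↦ zero_le) fun n ↦ lintegral_specMeasure_le_sobolevSq hH.le ((hφ n).sub hf)
  · simp_rw [fun n ↦ lintegral_specMeasure_half ((hφ n).sub hf) ((hφ2 n).sub hf2)]
    exact hsq hpi (h.2.1 le_rfl)
  · refine tendsto_of_tendsto_of_tendsto_of_le_of_le tendsto_const_nhds ?_
      (fun _ ↦ zero_le) fun n ↦ lintegral_specMeasure_le_of_half_lt hH ((hφ n).sub hf)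
        ((hφ2 n).sub hf2)
    simpa using (hsq (ENNReal.mul_ne_top ENNReal.ofNat_ne_top
      (lintegral_specMeasure_ne_top hH0 hH1)) (h.2.2 hH)).add (hsq hpi (h.2.1 hH.le))

/-! ### Approximation of truncated Lipschitz functions by steps and by mollification. -/

section Approximation

variable {g : ℝ → ℂ} {M : ℝ} {L : ℝ≥0}

lemma IsClampLipschitz.integrable_indicator {a b : ℝ} (hg : IsClampLipschitz g a b M L) :
    Integrable (indicator (Ioo a b) g) :=
  (integrable_indicator_iff measurableSet_Ioo).2
    (hg.lipschitz.continuous.integrableOn_Icc.mono_set Ioo_subset_Icc_self)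

lemma IsClampLipschitz.norm_indicator_le {a b : ℝ} (hg : IsClampLipschitz g a b M L) (y : ℝ) :
    ‖indicator (Ioo a b) g y‖ ≤ M :=
  (norm_indicator_le_norm_self g y).trans (hg.bound y)

lemma IsClampLipschitz.memLp_indicator {a b : ℝ} (hg : IsClampLipschitz g a b M L) :
    MemLp (indicator (Ioo a b) g) 2 := by
  rw [memLp_indicator_iff_restrict measurableSet_Ioo]
  exact MemLp.of_bound hg.lipschitz.continuous.aestronglyMeasurable M (ae_of_all _ hg.bound)

/-- The step function interpolating `g` on the uniform partition of `[0, 1]` into `n + 1`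
intervals. -/
def unitStep (g : ℝ → ℂ) (n : ℕ) : ℝ → ℂ :=
  partStep (n + 1) (fun k ↦ k * ((n : ℝ) + 1)⁻¹) fun k ↦ g (k * ((n : ℝ) + 1)⁻¹)

lemma monotone_unit (n : ℕ) : Monotone fun k : ℕ ↦ (k : ℝ) * ((n : ℝ) + 1)⁻¹ := by
  intro i j hij
  simp only
  gcongr

lemma unit_mesh (n k : ℕ) : (k : ℝ) * ((n : ℝ) + 1)⁻¹ ∈
      Icc ((k : ℝ) * ((n : ℝ) + 1)⁻¹) (((k + 1 : ℕ) : ℝ) * ((n : ℝ) + 1)⁻¹) ∧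
    ((k + 1 : ℕ) : ℝ) * ((n : ℝ) + 1)⁻¹ - (k : ℝ) * ((n : ℝ) + 1)⁻¹ ≤ ((n : ℝ) + 1)⁻¹ := by
  refine ⟨⟨le_rfl, monotone_unit n (Nat.le_succ k)⟩, ?_⟩
  push_cast
  linarith

lemma IsClampLipschitz.abs_mul_norm_fourierT_unitStep_le (hg : IsClampLipschitz g 0 1 M L) (n : ℕ)
    (z : ℝ) : |z| * ‖fourierT (unitStep g n) z‖ ≤ 2 * M + L * (1 - 0) :=
  hg.abs_mul_norm_fourierT_le (monotone_unit n) (fun k _ ↦ (unit_mesh n k).1) z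

/-- The point `y = 1` is excluded: it lies in the last half-open cell but not in `(0, 1)`. -/
lemma IsClampLipschitz.norm_unitStep_sub_le (hg : IsClampLipschitz g 0 1 M L) (n : ℕ) (y : ℝ)
    (hy : y ≠ 1) : ‖(unitStep g n - indicator (Ioo 0 1) g) y‖ ≤
      indicator (Icc 0 1) (fun _ ↦ L * ((n : ℝ) + 1)⁻¹) y := by
  have h := hg.norm_partStep_sub_le (N := n + 1) (monotone_unit n) (fun k _ ↦ unit_mesh n k) y
  have h0 : ((0 : ℕ) : ℝ) * ((n : ℝ) + 1)⁻¹ = 0 := by simp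
  have h1 : ((n + 1 : ℕ) : ℝ) * ((n : ℝ) + 1)⁻¹ = 1 := by
    push_cast
    exact mul_inv_cancel₀ (by positivity)
  rw [h0, h1] at h
  rw [Pi.sub_apply]
  by_cases hy' : y ∈ Ioo (0 : ℝ) 1
  · rw [indicator_of_mem hy', indicator_of_mem (Ioo_subset_Icc_self hy')]
    rcases h with h | h
    · exact absurd (Ioo_subset_Ioc_self hy') h.1
    · exact h
  · have hy'' : y ∉ Ioc (0 : ℝ) 1 := fun h' ↦ hy' ⟨h'.1, lt_of_le_of_ne h'.2 hy⟩
    rcases partStep_eq (monotone_unit n) (fun k ↦ g (k * ((n : ℝ) + 1)⁻¹)) (n + 1) y with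
      ⟨-, h2⟩ | ⟨k, hk, h2, -⟩
    · rw [indicator_of_notMem hy', unitStep, h2, sub_zero, norm_zero]
      exact indicator_nonneg (fun _ _ ↦ by positivity) y
    · refine absurd ⟨lt_of_le_of_lt ?_ h2.1, h2.2.trans ?_⟩ hy''
      · positivity
      · exact (monotone_unit n hk).trans_eq h1

lemma IsClampLipschitz.integral_norm_unitStep_sub_le (hg : IsClampLipschitz g 0 1 M L) (n : ℕ) :
    ∫ y, ‖(unitStep g n - indicator (Ioo 0 1) g) y‖ ≤ L * ((n : ℝ) + 1)⁻¹ := by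
  calc _ ≤ ∫ y, indicator (Icc (0 : ℝ) 1) (fun _ ↦ L * ((n : ℝ) + 1)⁻¹) y := by
        refine integral_mono_of_nonneg (ae_of_all _ fun y ↦ norm_nonneg _) ?_ ?_
        · exact (integrable_indicator_iff measurableSet_Icc).2 continuous_const.integrableOn_Icc
        · filter_upwards [(countable_singleton (1 : ℝ)).ae_notMem volume] with y hy
          exact hg.norm_unitStep_sub_le n y hy
    _ = _ := by
        rw [integral_indicator measurableSet_Icc]
        simp

lemma IsClampLipschitz.tendsto_integral_norm_unitStep_sub (hg : IsClampLipschitz g 0 1 M L) :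
    Tendsto (fun n ↦ ∫ y, ‖(unitStep g n - indicator (Ioo 0 1) g) y‖) atTop (𝓝 0) := by
  refine tendsto_of_tendsto_of_tendsto_of_le_of_le tendsto_const_nhds ?_
    (fun _ ↦ integral_nonneg fun _ ↦ norm_nonneg _) hg.integral_norm_unitStep_sub_le
  simpa using (tendsto_one_div_add_atTop_nhds_zero_nat (𝕜 := ℝ)).const_mul (L : ℝ)

lemma IsClampLipschitz.abs_mul_norm_fourierT_indicator_le (hg : IsClampLipschitz g 0 1 M L)
    (z : ℝ) : |z| * ‖fourierT (indicator (Ioo 0 1) g) z‖ ≤ 2 * M + L * (1 - 0) := by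
  refine abs_mul_norm_fourierT_le_of_approx hg.integrable_indicator (fun η hη ↦ ?_) z
  obtain ⟨n, hn⟩ := (hg.tendsto_integral_norm_unitStep_sub.eventually_le_const hη).exists
  exact ⟨_, integrable_partStep _ _ _, hn, hg.abs_mul_norm_fourierT_unitStep_le n⟩

lemma IsClampLipschitz.integrandTendsto_unitStep (hg : IsClampLipschitz g 0 1 M L) {H : ℝ}
    (hH0 : 0 < H) : IntegrandTendsto H (unitStep g) (indicator (Ioo 0 1) g) := by
  refine integrandTendsto_of_bounded_variation hH0 (fun n ↦ integrable_partStep _ _ _)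
    hg.integrable_indicator (M := M + M) hg.tendsto_integral_norm_unitStep_sub
    (fun n ↦ abs_mul_norm_fourierT_sub_le (integrable_partStep _ _ _) hg.integrable_indicator
      (hg.abs_mul_norm_fourierT_unitStep_le n) hg.abs_mul_norm_fourierT_indicator_le)
    fun n y ↦ (norm_sub_le _ _).trans (add_le_add ?_ (hg.norm_indicator_le y))
  rcases partStep_eq (monotone_unit n) (fun k ↦ g (k * ((n : ℝ) + 1)⁻¹)) (n + 1) y with
    ⟨-, h2⟩ | ⟨k, hk, -, h2⟩
  · rw [unitStep, h2, norm_zero]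
    exact (norm_nonneg _).trans (hg.bound 0)
  · rw [unitStep, h2]
    exact hg.bound _

open scoped Convolution FourierTransform

/-- A smooth bump function of radius `1 / (n + 1)`. -/
def mollBump (n : ℕ) : ContDiffBump (0 : ℝ) where
  rIn := ((n : ℝ) + 1)⁻¹ / 2
  rOut := ((n : ℝ) + 1)⁻¹
  rIn_pos := by positivity
  rIn_lt_rOut := half_lt_self (by positivity)

/-- The mollification of `f` at scale `1 / (n + 1)`. -/
def mollify (f : ℝ → ℂ) (n : ℕ) : ℝ → ℂ :=
  (mollBump n).normed volume ⋆[ContinuousLinearMap.lsmul ℝ ℝ, volume] f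

lemma mollBump_normed_eq_zero {n : ℕ} {t : ℝ} (ht : 1 ≤ |t|) :
    (mollBump n).normed volume t = 0 := by
  by_contra h
  have h1 : t ∈ Function.support ((mollBump n).normed volume) := h
  rw [ContDiffBump.support_normed_eq, mem_ball_zero_iff, Real.norm_eq_abs] at h1
  have h2 : (mollBump n).rOut ≤ 1 := by
    change ((n : ℝ) + 1)⁻¹ ≤ 1
    exact inv_le_one_of_one_le₀ (by linarith [(n.cast_nonneg : (0 : ℝ) ≤ n)])
  linarith

lemma mollify_eq_zero {f : ℝ → ℂ} (hf : ∀ y ∉ Icc (0 : ℝ) 1, f y = 0) (n : ℕ) {y : ℝ}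
    (hy : y ∉ Icc (-1 : ℝ) 2) : mollify f n y = 0 := by
  rw [mollify, convolution_lsmul]
  refine integral_eq_zero_of_ae (ae_of_all _ fun t ↦ ?_)
  simp only [Pi.zero_apply]
  rcases le_or_gt 1 |t| with ht | ht
  · rw [mollBump_normed_eq_zero ht, zero_smul]
  · rw [hf, smul_zero]
    rw [abs_lt] at ht
    exact fun h ↦ hy ⟨by linarith [h.1], by linarith [h.2]⟩

lemma contDiff_mollify {f : ℝ → ℂ} (hf : Integrable f) (n : ℕ) :
    ContDiff ℝ ((⊤ : ℕ∞) : WithTop ℕ∞) (mollify f n) :=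
  (mollBump n).hasCompactSupport_normed.contDiff_convolution_left _ (mollBump n).contDiff_normed
    hf.locallyIntegrable

lemma hasCompactSupport_mollify {f : ℝ → ℂ} (hf : ∀ y ∉ Icc (0 : ℝ) 1, f y = 0) (n : ℕ) :
    HasCompactSupport (mollify f n) :=
  HasCompactSupport.intro isCompact_Icc fun _ hy ↦ mollify_eq_zero hf n hy

lemma norm_mollify_le {f : ℝ → ℂ} {M : ℝ} (hM : ∀ y, ‖f y‖ ≤ M) (n : ℕ) (y : ℝ) :
    ‖mollify f n y‖ ≤ M := by
  rw [mollify, convolution_lsmul]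
  calc _ ≤ ∫ t, (mollBump n).normed volume t * M := by
        refine norm_integral_le_of_norm_le ((mollBump n).integrable_normed.mul_const M)
          (ae_of_all _ fun t ↦ ?_)
        rw [norm_smul, Real.norm_of_nonneg ((mollBump n).nonneg_normed t)]
        gcongr
        · exact (mollBump n).nonneg_normed t
        · exact hM _
    _ = M := by rw [integral_mul_const, (mollBump n).integral_normed, one_mul]

/-- Convolution with a probability density multiplies the transform by a factor of modulus at most
`1`, so mollification preserves the decay bound. -/
lemma norm_fourierT_mollify_le {f : ℝ → ℂ} (hf : Integrable f) (n : ℕ) (z : ℝ) :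
    ‖fourierT (mollify f n) z‖ ≤ ‖fourierT f z‖ := by
  set ρ : ℝ → ℂ := fun y ↦ ((mollBump n).normed volume y : ℂ) with hρ
  have hρi : Integrable ρ := (mollBump n).integrable_normed.ofReal
  have h1 : mollify f n = ρ ⋆[ContinuousLinearMap.mul ℂ ℂ, volume] f := by
    ext y
    rw [mollify, convolution_lsmul, convolution_def]
    rfl
  have h2 : ∫ y, ‖ρ y‖ = 1 := by
    rw [← (mollBump n).integral_normed (μ := volume)]
    refine integral_congr_ae (ae_of_all _ fun y ↦ ?_)
    simp only [hρ, Complex.norm_real]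
    exact Real.norm_of_nonneg ((mollBump n).nonneg_normed y)
  have h3 := norm_fourierT_le ρ z
  rw [fourierT_eq_fourier, h1, Real.fourier_mul_convolution_eq hρi hf, norm_mul,
    ← fourierT_eq_fourier, ← fourierT_eq_fourier]
  rw [h2] at h3
  exact mul_le_of_le_one_left (norm_nonneg _) h3

lemma tendsto_integral_norm_mollify_sub {f : ℝ → ℂ} (hf : Integrable f)
    (hf0 : ∀ y ∉ Icc (0 : ℝ) 1, f y = 0) {M : ℝ} (hM : ∀ y, ‖f y‖ ≤ M) :
    Tendsto (fun n ↦ ∫ y, ‖(mollify f n - f) y‖) atTop (𝓝 0) := by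
  have hr : Tendsto (fun n ↦ (mollBump n).rOut) atTop (𝓝 0) := by
    simpa [mollBump] using tendsto_one_div_add_atTop_nhds_zero_nat (𝕜 := ℝ)
  -- `K = 2` is the fixed ratio of outer to inner radius; it gives convergence almost everywhere,
  -- which the bound `M + M` on `[-1, 2]` turns into `L¹` convergence.
  have hae := ContDiffBump.ae_convolution_tendsto_right_of_locallyIntegrable (K := 2) hr
    (Eventually.of_forall fun n ↦ le_of_eq (by simp only [mollBump]; ring)) hf.locallyIntegrable
  rw [← integral_zero ℝ ℝ (μ := volume)]
  refine tendsto_integral_of_dominated_convergence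
    (indicator (Icc (-1 : ℝ) 2) fun _ ↦ M + M) (fun n ↦ ?_) ?_ (fun n ↦ ae_of_all _ fun y ↦ ?_) ?_
  · exact ((contDiff_mollify hf n).continuous.aestronglyMeasurable.sub hf.1).norm
  · exact (integrable_indicator_iff measurableSet_Icc).2 continuous_const.integrableOn_Icc
  · rw [norm_norm]
    by_cases hy : y ∈ Icc (-1 : ℝ) 2
    · rw [indicator_of_mem hy]
      exact (norm_sub_le _ _).trans (add_le_add (norm_mollify_le hM n y) (hM y))
    · rw [indicator_of_notMem hy, Pi.sub_apply, mollify_eq_zero hf0 n hy, hf0 y, sub_zero,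
        norm_zero]
      exact fun h ↦ hy ⟨by linarith [h.1], by linarith [h.2]⟩
  · filter_upwards [hae] with y hy
    simpa [mollify] using (hy.sub_const (f y)).norm

lemma IsClampLipschitz.integrandTendsto_mollify (hg : IsClampLipschitz g 0 1 M L) {H : ℝ}
    (hH0 : 0 < H) :
    IntegrandTendsto H (mollify (indicator (Ioo 0 1) g)) (indicator (Ioo 0 1) g) := by
  have hf0 : ∀ y ∉ Icc (0 : ℝ) 1, indicator (Ioo 0 1) g y = 0 := fun y hy ↦
    indicator_of_notMem (fun h ↦ hy (Ioo_subset_Icc_self h)) g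
  have hi := hg.integrable_indicator
  have hmi := fun n ↦ (contDiff_mollify hi n).continuous.integrable_of_hasCompactSupport
    (hasCompactSupport_mollify hf0 n) (μ := volume)
  exact integrandTendsto_of_bounded_variation hH0 hmi hi (M := M + M)
    (tendsto_integral_norm_mollify_sub hi hf0 hg.norm_indicator_le)
    (fun n ↦ abs_mul_norm_fourierT_sub_le (hmi n) hi
      (fun z ↦ (mul_le_mul_of_nonneg_left (norm_fourierT_mollify_le hi n z)
        (abs_nonneg z)).trans (hg.abs_mul_norm_fourierT_indicator_le z))
      hg.abs_mul_norm_fourierT_indicator_le)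
    fun n y ↦ (norm_sub_le _ _).trans (add_le_add (norm_mollify_le hg.norm_indicator_le n y)
      (hg.norm_indicator_le y))

end Approximation

/-! ### Existence, uniqueness and second moment of the Wiener integral. -/

section WienerIntegral

variable {Ω : Type*} [MeasurableSpace Ω] {P : Measure Ω} {H : ℝ} {B : ℝ → Ω → ℝ}

lemma tendsto_eLpNorm_sub_of_isSpectralIntegral (hB : IsFBM P H B) (hH0 : 0 < H) (hH1 : H < 1)
    {f : ℝ → ℂ} (hf2 : MemLp f 2) {X : Ω → ℂ} (hX : IsSpectralIntegral P H B f X)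
    {φ : ℕ → ℝ → ℂ} {Y : ℕ → Ω → ℂ}
    (hφ : ∀ n, IsStepIntegral B (φ n) (Y n) ∨ IsTestIntegral P B (φ n) (Y n))
    (h : IntegrandTendsto H φ f) :
    Tendsto (fun n ↦ eLpNorm (fun ϖ ↦ Y n ϖ - X ϖ) 2 P) atTop (𝓝 0) := by
  have hs : ∀ n, IsSpectralIntegral P H B (φ n) (Y n) := fun n ↦
    (hφ n).elim (·.isSpectralIntegral hB) (·.isSpectralIntegral hH0 hH1)
  have hφ2 : ∀ n, MemLp (φ n) 2 := fun n ↦ (hφ n).elim (·.memLp_fun) (·.memLp_fun)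
  have h1 := h.tendsto_eLpNorm_fourierT hH0 hH1 (fun n ↦ (hs n).1) hφ2 hX.1 hf2
  have h2 := ENNReal.Tendsto.const_mul h1 (Or.inr (ENNReal.ofReal_ne_top (r := CH H)))
  rw [mul_zero] at h2
  exact h2.congr fun n ↦ ((hs n).eLpNorm_sub hB hH0 hH1 hX).symm

/-- Uniqueness and the second moment are read off from this. The clause `exists_step` matters: it
supplies a sequence to which the convergence clause applies. -/
lemma IsWienerIntegral.isSpectralIntegral (hH0 : 0 < H) (hH1 : H < 1)
    {f : ℝ → ℂ} (hf : Integrable f) (hf2 : MemLp f 2) {X : Ω → ℂ}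
    (h : IsWienerIntegral P H B f X) : IsSpectralIntegral P H B f X := by
  obtain ⟨ψ, Z, hs, hψ⟩ := h.exists_step
  exact ⟨hf, h.memLp, ψ, Z, hs, h.tendsto ψ Z (fun n ↦ Or.inl (hs n)) hψ,
    hψ.tendsto_eLpNorm_fourierT hH0 hH1 (fun n ↦ (hs n).integrable) (fun n ↦ (hs n).memLp_fun)
      hf hf2⟩

lemma IsSpectralIntegral.ae_eq (hB : IsFBM P H B) (hH0 : 0 < H) (hH1 : H < 1) {f : ℝ → ℂ}
    {X X' : Ω → ℂ} (hX : IsSpectralIntegral P H B f X) (hX' : IsSpectralIntegral P H B f X') :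
    X =ᵐ[P] X' := by
  have h := hX.eLpNorm_sub hB hH0 hH1 hX'
  have h0 : fourierT (0 : ℝ → ℂ) = 0 := by ext; simp [fourierT]
  rw [sub_self, h0, eLpNorm_zero, mul_zero,
    eLpNorm_eq_zero_iff (hX.2.1.sub hX'.2.1).1 two_ne_zero] at h
  filter_upwards [h] with ϖ hϖ
  exact sub_eq_zero.1 hϖ

lemma IsSpectralIntegral.integral_norm_sq (hB : IsFBM P H B) (hH0 : 0 < H) (hH1 : H < 1)
    {f : ℝ → ℂ} {X : Ω → ℂ} (hX : IsSpectralIntegral P H B f X) :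
    Integrable (fun ζ : ℝ ↦ ‖fourierT f ζ‖ ^ 2 / |ζ| ^ (2 * H - 1)) ∧
      ∫ ϖ, ‖X ϖ‖ ^ 2 ∂P = CH H ^ 2 * ∫ ζ : ℝ, ‖fourierT f ζ‖ ^ 2 / |ζ| ^ (2 * H - 1) := by
  have hC := CH_pos hH0 hH1
  have hm := (continuous_fourierT hX.1).measurable
  have hw : ∀ ζ : ℝ, ‖fourierT f ζ‖ ^ 2 / |ζ| ^ (2 * H - 1) =
      ‖fourierT f ζ‖ ^ 2 * |ζ| ^ (1 - 2 * H) := fun ζ ↦ by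
    rw [show 1 - 2 * H = -(2 * H - 1) by ring, Real.rpow_neg (abs_nonneg ζ), div_eq_mul_inv]
  have h := hX.eLpNorm_eq hB hH0 hH1
  -- As `C_H > 0`, an infinite spectral norm would contradict `X ∈ L²(P)`; the finiteness of the
  -- spectral integral thus comes from the isometry.
  have hfin : eLpNorm (fourierT f) 2 (specMeasure H) ≠ ∞ := fun h' ↦ by
    rw [h', ENNReal.mul_top (by simpa using hC)] at h
    exact hX.2.1.2.ne h
  have h2 := congrArg (· ^ 2) h
  rw [mul_pow, eLpNorm_two_sq_eq_ofReal hX.2.1, ← ENNReal.ofReal_pow hC.le, eLpNorm_two_sq,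
    lintegral_specMeasure hm] at h2
  have hlt : ∫⁻ z, ENNReal.ofReal (‖fourierT f z‖ ^ 2 * |z| ^ (1 - 2 * H)) ≠ ∞ := by
    rw [← lintegral_specMeasure hm, ← eLpNorm_two_sq]
    exact ENNReal.pow_ne_top hfin
  have hint : Integrable fun ζ : ℝ ↦ ‖fourierT f ζ‖ ^ 2 * |ζ| ^ (1 - 2 * H) :=
    (lintegral_ofReal_ne_top_iff_integrable (Measurable.aestronglyMeasurable (by fun_prop))
      (ae_of_all _ fun z ↦ by positivity)).1 hlt
  simp_rw [hw]
  refine ⟨hint, ?_⟩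
  rw [← ofReal_integral_eq_lintegral_ofReal hint (ae_of_all _ fun z ↦ by positivity),
    ← ENNReal.ofReal_mul (by positivity)] at h2
  exact (ENNReal.ofReal_eq_ofReal_iff (integral_nonneg fun _ ↦ by positivity)
    (mul_nonneg (by positivity) (integral_nonneg fun _ ↦ by positivity))).1 h2

lemma IsClampLipschitz.exists_isWienerIntegral (hB : IsFBM P H B) (hH0 : 0 < H) (hH1 : H < 1)
    {g : ℝ → ℂ} {M : ℝ} {L : ℝ≥0} (hg : IsClampLipschitz g 0 1 M L) :
    ∃ X, IsWienerIntegral P H B (indicator (Ioo 0 1) g) X := by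
  have hi := hg.integrable_indicator
  have hi2 := hg.memLp_indicator
  have hs := fun n ↦ isStepIntegral_partStep B (monotone_unit n)
    (fun k ↦ g (k * ((n : ℝ) + 1)⁻¹)) (n + 1)
  have hstep := hg.integrandTendsto_unitStep hH0
  obtain ⟨X, hX⟩ := exists_isSpectralIntegral hB hH0 hH1 hi hs
    (hstep.tendsto_eLpNorm_fourierT hH0 hH1 (fun n ↦ (hs n).integrable)
      (fun n ↦ (hs n).memLp_fun) hi hi2)
  have htest : ∀ n, ∃ Y, IsTestIntegral P B (mollify (indicator (Ioo 0 1) g) n) Y := fun n ↦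
    exists_isTestIntegral hB hH0 hH1 (contDiff_mollify hi n)
      (hasCompactSupport_mollify (fun y hy ↦
        indicator_of_notMem (fun h ↦ hy (Ioo_subset_Icc_self h)) g) n)
  choose Y hY using htest
  exact ⟨X, hX.2.1, ⟨_, _, hs, hstep⟩, ⟨_, _, hY, hg.integrandTendsto_mollify hH0⟩,
    fun φ Y h h' ↦ tendsto_eLpNorm_sub_of_isSpectralIntegral hB hH0 hH1 hi2 hX h h'⟩

end WienerIntegral

/-! ### Sobolev regularity and its failure at a jump. -/

section Sobolev

variable {g : ℝ → ℂ} {M : ℝ} {L : ℝ≥0}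

/-- Boundedness and decay together give `(1 + z²) |f̂|² ≤ ‖f‖₁² + K²`, and `(1 + z²)^{γ - 1}` is
integrable for `γ < 1/2`. -/
lemma IsClampLipschitz.memH (hg : IsClampLipschitz g 0 1 M L) {γ : ℝ} (hγ : γ < 1 / 2) :
    MemH γ (indicator (Ioo 0 1) g) := by
  refine ⟨hg.memLp_indicator, ?_⟩
  set f := indicator (Ioo 0 1) g with hf
  set K : ℝ := 2 * M + L * (1 - 0) with hK
  rw [sobolevSq_eq hg.integrable_indicator]
  calc _ ≤ ∫⁻ z, ENNReal.ofReal ((∫ y, ‖f y‖) ^ 2 + K ^ 2) * ENNReal.ofReal ((1 + z ^ 2)⁻¹)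
          ∂(sobolevMeasure γ) := by
        refine lintegral_mono fun z ↦ ?_
        rw [← ofReal_norm, ← ENNReal.ofReal_pow (norm_nonneg _), ← ENNReal.ofReal_mul (by positivity)]
        refine ENNReal.ofReal_le_ofReal ?_
        rw [← div_eq_mul_inv, le_div_iff₀ (by positivity)]
        have h1 : ‖fourierT f z‖ ^ 2 ≤ (∫ y, ‖f y‖) ^ 2 := by
          gcongr
          exact norm_fourierT_le f z
        have h2 : (|z| * ‖fourierT f z‖) ^ 2 ≤ K ^ 2 := by
          gcongr
          exact hg.abs_mul_norm_fourierT_indicator_le z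
        rw [mul_pow, sq_abs] at h2
        linarith
    _ < ∞ := by
        rw [lintegral_const_mul _ (by fun_prop)]
        exact ENNReal.mul_lt_top ENNReal.ofReal_lt_top (lintegral_sobolevMeasure_ne_top hγ).lt_top

/-- A function with a jump is not in `𝓗¹(ℝ)`. -/
lemma not_memH_one_of_jump (hg : Continuous g) (hi : Integrable (indicator (Ioo 0 1) g))
    (h0 : g 0 ≠ 0) : ¬ MemH 1 (indicator (Ioo 0 1) g) := by
  rintro ⟨hf2, hS⟩
  set f := indicator (Ioo 0 1) g with hf
  have hc : 0 < ‖g 0‖ / 2 := by positivity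
  set c := ‖g 0‖ / 2 with hc'
  obtain ⟨r, hr, hgr⟩ : ∃ r > 0, ∀ y, |y| < r → c ≤ ‖g y‖ := by
    have h1 : ∀ᶠ y in 𝓝 (0 : ℝ), c < ‖g y‖ :=
      hg.norm.continuousAt.eventually_const_lt (by rw [hc']; linarith)
    obtain ⟨r, hr, h⟩ := Metric.eventually_nhds_iff.1 h1
    exact ⟨r, hr, fun y hy ↦ (h (by simpa using hy)).le⟩
  -- Compare two bounds on `‖f(· + h) - f‖₂²`. Plancherel and `|e^{izh} - 1| ≤ |zh|` give an upper
  -- bound of order `h²`; on `(-h, 0)` the difference is `g (y + h)`, of modulus at least `c`, which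
  -- gives the lower bound `c² h`. Division by `h` leaves the claim, contradictory as `h → 0`.
  have key : ∀ h : ℝ, 0 < h → h < r → h < 1 →
      2 * Real.pi * c ^ 2 ≤ h * (sobolevSq 1 f).toReal := by
    intro h hh0 hhr hh1
    have hih : Integrable fun y ↦ f (y + h) := hi.comp_add_right h
    have hf2h : MemLp (fun y ↦ f (y + h)) 2 :=
      hf2.comp_measurePreserving (measurePreserving_add_right volume h)
    have hP := lintegral_enorm_fourierT_sq (hih.sub hi) (hf2h.sub hf2)
    have hup : ∫⁻ z, ‖fourierT ((fun y ↦ f (y + h)) - f) z‖ₑ ^ 2 ≤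
        ENNReal.ofReal (h ^ 2) * sobolevSq 1 f := by
      rw [sobolevSq, ← lintegral_const_mul' _ _ ENNReal.ofReal_ne_top]
      refine lintegral_mono fun z ↦ ?_
      rw [fourierT_sub hih hi, Pi.sub_apply, fourierT_comp_add_right, ← sub_one_mul, enorm_mul,
        mul_pow, ← mul_assoc, Real.rpow_one, ← ENNReal.ofReal_mul (by positivity)]
      gcongr
      have h1 : ‖Complex.exp (Complex.I * z * h) - 1‖ ≤ |z * h| := by
        have := Real.norm_exp_I_mul_ofReal_sub_one_le (x := z * h)
        rwa [Complex.ofReal_mul, ← mul_assoc, Real.norm_eq_abs] at this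
      rw [← ofReal_norm, ← ENNReal.ofReal_pow (norm_nonneg _)]
      refine ENNReal.ofReal_le_ofReal ?_
      calc _ ≤ |z * h| ^ 2 := by gcongr
        _ = h ^ 2 * z ^ 2 := by rw [sq_abs]; ring
        _ ≤ _ := by gcongr; linarith
    have hlow : ENNReal.ofReal (c ^ 2 * h) ≤ ∫⁻ y, ‖((fun y ↦ f (y + h)) - f) y‖ₑ ^ 2 := by
      calc _ = ∫⁻ _ in Ioo (-h) 0, ENNReal.ofReal (c ^ 2) := by
            rw [setLIntegral_const, Real.volume_Ioo, ENNReal.ofReal_mul (by positivity)]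
            simp
        _ ≤ ∫⁻ y in Ioo (-h) 0, ‖((fun y ↦ f (y + h)) - f) y‖ₑ ^ 2 := by
            refine setLIntegral_mono' measurableSet_Ioo fun y hy ↦ ?_
            have h1 : f y = 0 := indicator_of_notMem (fun h' : y ∈ Ioo (0 : ℝ) 1 ↦ by linarith [h'.1, hy.2]) g
            have h2 : f (y + h) = g (y + h) :=
              indicator_of_mem (show y + h ∈ Ioo (0 : ℝ) 1 from
                ⟨by linarith [hy.1], by linarith [hy.2]⟩) g
            rw [Pi.sub_apply, h1, sub_zero, h2, ← ofReal_norm,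
              ← ENNReal.ofReal_pow (norm_nonneg _)]
            refine ENNReal.ofReal_le_ofReal ?_
            gcongr
            refine hgr _ ?_
            rw [abs_lt]
            constructor <;> linarith [hy.1, hy.2]
        _ ≤ _ := setLIntegral_le_lintegral _ _
    have h3 : ENNReal.ofReal (2 * Real.pi) * ENNReal.ofReal (c ^ 2 * h) ≤
        ENNReal.ofReal (h ^ 2) * sobolevSq 1 f :=
      (mul_le_mul_right hlow _).trans (hP.symm.le.trans hup)
    have hpi := Real.pi_pos
    rw [← ENNReal.ofReal_toReal hS.ne, ← ENNReal.ofReal_mul (by positivity),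
      ← ENNReal.ofReal_mul (by positivity), ENNReal.ofReal_le_ofReal_iff
        (mul_nonneg (by positivity) ENNReal.toReal_nonneg)] at h3
    refine le_of_mul_le_mul_right ?_ hh0
    linarith
  have hlim : Tendsto (fun h : ℝ ↦ h * (sobolevSq 1 f).toReal) (𝓝[>] 0) (𝓝 0) := by
    have : Tendsto (fun h : ℝ ↦ h * (sobolevSq 1 f).toReal) (𝓝 0) (𝓝 (0 * _)) :=
      tendsto_id.mul_const _
    rw [zero_mul] at this
    exact this.mono_left nhdsWithin_le_nhds
  have hpos : 2 * Real.pi * c ^ 2 ≤ 0 := by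
    refine ge_of_tendsto hlim ?_
    filter_upwards [Ioo_mem_nhdsGT (lt_min hr one_pos)] with h hh
    exact key h hh.1 (hh.2.trans_le (min_le_left _ _)) (hh.2.trans_le (min_le_right _ _))
  have := Real.pi_pos
  exact absurd hpos (not_le.2 (by positivity))

end Sobolev

/-! ### Regularity of the Green function and its value at `y = 0`. -/

section Green

variable {n : ℕ} (α : Fin n → ℝ)

/-- For `ω ≠ 0` the only non-smooth ingredient is `|x - y|`; it is treated as a separate variable of
a smooth function `Φ`. -/
lemma locallyLipschitz_green (ω x : ℝ) : LocallyLipschitz (green α ω x) := by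
  have h1 : LocallyLipschitz fun y : ℝ ↦ (|x - y|, y) :=
    LocallyLipschitz.prodMk (by
      have : LipschitzWith 1 fun y : ℝ ↦ |x - y| := LipschitzWith.mk_one fun y y' ↦ by
        rw [Real.dist_eq, Real.dist_eq]
        refine (abs_abs_sub_abs_le_abs_sub _ _).trans_eq ?_
        rw [sub_sub_sub_cancel_left, abs_sub_comm]
      exact this.locallyLipschitz) .id
  by_cases hω : ω = 0
  · have h2 : green α ω x = fun y ↦ ((max x y - 1 : ℝ) : ℂ) := by
      ext y
      simp [green, hω]
    rw [h2]
    have h3 : LocallyLipschitz fun y : ℝ ↦ max x y := LocallyLipschitz.id.const_max x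
    have h4 : LocallyLipschitz fun r : ℝ ↦ ((r - 1 : ℝ) : ℂ) :=
      ContDiff.locallyLipschitz (𝕂 := ℝ)
        (Complex.ofRealCLM.contDiff.comp (contDiff_id.sub contDiff_const))
    exact h4.comp h3
  · set w := csqrt (freqS α ω) with hw
    set Φ : ℝ × ℝ → ℂ := fun p ↦ (Complex.exp (w * ((x + p.2 : ℝ) : ℂ))
      + Complex.exp (w * ((p.1 : ℝ) : ℂ)) - Complex.exp (w * ((2 - x - p.2 : ℝ) : ℂ))
      - Complex.exp (w * ((2 - p.1 : ℝ) : ℂ))) / (2 * w * (1 + Complex.exp (2 * w))) with hΦ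
    have hs : ∀ {q : ℝ × ℝ → ℝ}, ContDiff ℝ 1 q →
        ContDiff ℝ 1 fun p ↦ Complex.exp (w * (q p : ℂ)) := fun hq ↦
      (contDiff_const.mul (Complex.ofRealCLM.contDiff.comp hq)).cexp
    have h2 : ContDiff ℝ 1 Φ :=
      ((((hs (contDiff_const.add contDiff_snd)).add (hs contDiff_fst)).sub
        (hs (contDiff_const.sub contDiff_snd))).sub (hs (contDiff_const.sub contDiff_fst))).div_const _
    have h3 : green α ω x = Φ ∘ fun y : ℝ ↦ (|x - y|, y) := by
      ext y
      simp [green, hω, hΦ, hw]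
    rw [h3]
    exact (ContDiff.locallyLipschitz h2).comp h1

/-- Composing with the 1-Lipschitz retraction of `ℝ` onto `[0, 1]` makes the function globally
bounded and Lipschitz without changing it on `[0, 1]`. -/
lemma exists_isClampLipschitz_green (ω x : ℝ) : ∃ (g : ℝ → ℂ) (M : ℝ) (L : ℝ≥0),
    IsClampLipschitz g 0 1 M L ∧ greenExt α ω x = indicator (Ioo 0 1) g ∧ g 0 = green α ω x 0 := by
  obtain ⟨L, hL⟩ := LocallyLipschitzOn.exists_lipschitzOnWith_of_compact
    (isCompact_Icc (a := (0 : ℝ)) (b := 1)) ((locallyLipschitz_green α ω x).locallyLipschitzOn)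
  obtain ⟨M, hM⟩ := (isCompact_Icc (a := (0 : ℝ)) (b := 1)).exists_bound_of_continuousOn
    hL.continuousOn
  set q : ℝ → ℝ := fun y ↦ max 0 (min 1 y) with hq
  have hqm : ∀ y, q y ∈ Icc (0 : ℝ) 1 := fun y ↦
    ⟨le_max_left _ _, max_le zero_le_one (min_le_left _ _)⟩
  have hqL : LipschitzWith 1 q := (LipschitzWith.id.const_min 1).const_max 0
  have hq1 : ∀ y ∈ Icc (0 : ℝ) 1, q y = y := fun y hy ↦ by
    simp only [hq]
    rw [min_eq_right hy.2, max_eq_right hy.1]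
  refine ⟨green α ω x ∘ q, M, L, ⟨zero_le_one, ?_, fun y ↦ ?_, fun y ↦ hM _ (hqm y)⟩, ?_, ?_⟩
  · have := hL.comp (hqL.lipschitzOnWith (s := univ)) fun y _ ↦ hqm y
    rwa [mul_one, lipschitzOnWith_univ] at this
  · change green α ω x (q y) = green α ω x (q (q y))
    rw [hq1 _ (hqm y)]
  · ext y
    by_cases hy : y ∈ Ioo (0 : ℝ) 1
    · rw [greenExt, indicator_of_mem hy, indicator_of_mem hy, Function.comp_apply,
        hq1 y (Ioo_subset_Icc_self hy)]
    · rw [greenExt, indicator_of_notMem hy, indicator_of_notMem hy]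
  · rw [Function.comp_apply, hq1 0 (by simp)]

variable {α}

/-- The imaginary parts are `±|ω|^{α k} sin(π α k / 2)` with one sign, that of `ω`, for all `k`. No
cancellation occurs since `α k ∈ (0, 2]`, and the first term is nonzero since its exponent is below
`2`. -/
lemma freqS_im_ne_zero (hn : 0 < n) (hα_mem : ∀ k, α k ∈ Ioc (0 : ℝ) 2)
    (hα_first : α ⟨0, hn⟩ < 2) {ω : ℝ} (hω : ω ≠ 0) : (freqS α ω).im ≠ 0 := by
  have hpi := Real.pi_pos
  have hsin : ∀ k, 0 ≤ Real.sin (Real.pi / 2 * α k) := fun k ↦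
    Real.sin_nonneg_of_nonneg_of_le_pi (by have := (hα_mem k).1; positivity)
      (by nlinarith [(hα_mem k).2])
  have hsin0 : 0 < Real.sin (Real.pi / 2 * α ⟨0, hn⟩) :=
    Real.sin_pos_of_pos_of_lt_pi (by have := (hα_mem ⟨0, hn⟩).1; positivity) (by nlinarith)
  have hω' : 0 < |ω| := abs_pos.2 hω
  have hpos : 0 < ∑ k, |ω| ^ α k * Real.sin (Real.pi / 2 * α k) :=
    Finset.sum_pos' (fun k _ ↦ mul_nonneg (by positivity) (hsin k))
      ⟨⟨0, hn⟩, Finset.mem_univ _, mul_pos (by positivity) hsin0⟩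
  have him : (freqS α ω).im =
      ∑ k, |ω| ^ α k * Real.sin (Complex.arg (Complex.I * ω) * α k) := by
    rw [freqS, Complex.im_sum]
    refine Finset.sum_congr rfl fun k _ ↦ ?_
    rw [Complex.cpow_ofReal_im, norm_mul, Complex.norm_I, one_mul, Complex.norm_real,
      Real.norm_eq_abs]
  rw [him]
  rcases hω.lt_or_gt with h | h
  · have harg : Complex.arg (Complex.I * ω) = -(Real.pi / 2) := by
      rw [show Complex.I * ω = ((-ω : ℝ) : ℂ) * -Complex.I by push_cast; ring,
        Complex.arg_real_mul _ (by linarith), Complex.arg_neg_I]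
    simp only [harg, neg_mul, Real.sin_neg, mul_neg, Finset.sum_neg_distrib]
    exact neg_ne_zero.2 hpos.ne'
  · rw [mul_comm, Complex.arg_real_mul _ h, Complex.arg_I]
    exact hpos.ne'

/-- `Re √s = √((|s| + Re s) / 2)`, and `|Re s| < |s|` off the real axis. -/
lemma csqrt_re_pos {s : ℂ} (hs : s.im ≠ 0) : 0 < (csqrt s).re := by
  rw [csqrt, one_div, Complex.cpow_inv_two_re]
  refine Real.sqrt_pos.2 (half_pos ?_)
  have h1 := Complex.abs_re_lt_norm.2 hs
  linarith [neg_abs_le s.re]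

/-- For `ω ≠ 0`, with `w = √s`, the numerator at `y = 0` is `2(e^{wx} - e^{w(2 - x)})`. Its two
exponentials have different moduli because `Re w > 0` and `x < 2 - x`; likewise `|e^{2w}| > 1` keeps
the denominator from vanishing, so that division by zero plays no role. -/
lemma green_zero_ne_zero (hn : 0 < n) (hα_mem : ∀ k, α k ∈ Ioc (0 : ℝ) 2)
    (hα_first : α ⟨0, hn⟩ < 2) (ω : ℝ) {x : ℝ} (hx0 : 0 ≤ x) (hx1 : x < 1) :
    green α ω x 0 ≠ 0 := by
  by_cases hω : ω = 0
  · simp only [green, hω, if_true, max_eq_left hx0]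
    rw [Complex.ofReal_ne_zero]
    linarith
  have hre := csqrt_re_pos (freqS_im_ne_zero hn hα_mem hα_first hω)
  simp only [green, hω, if_false]
  set w := csqrt (freqS α ω) with hw
  have hw0 : w ≠ 0 := fun h ↦ by simp [h] at hre
  rw [add_zero, sub_zero, sub_zero, abs_of_nonneg hx0]
  refine div_ne_zero ?_ (mul_ne_zero (mul_ne_zero two_ne_zero hw0) ?_)
  · intro h
    have h1 : Complex.exp (w * ((x : ℝ) : ℂ)) = Complex.exp (w * ((2 - x : ℝ) : ℂ)) := by
      linear_combination h / 2
    have h2 := congrArg norm h1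
    rw [Complex.norm_exp, Complex.norm_exp, Complex.re_mul_ofReal, Complex.re_mul_ofReal,
      Real.exp_eq_exp] at h2
    nlinarith
  · intro h
    have h1 : Complex.exp (2 * w) = -1 := by linear_combination h
    have h2 := congrArg norm h1
    rw [Complex.norm_exp, norm_neg, norm_one, Real.exp_eq_one_iff] at h2
    simp at h2
    linarith

end Green

end FBMSource

end

theorem mainTheorem4 {Ω : Type*} [MeasurableSpace Ω] (P : Measure Ω) [IsProbabilityMeasure P]
    (H : ℝ) (hH0 : 0 < H) (hH1 : H < 1) (B : ℝ → Ω → ℝ) (hB : FBMSource.IsFBM P H B)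
    (n : ℕ) (hn : 0 < n) (α : Fin n → ℝ) (hα : StrictMono α)
    (hα_mem : ∀ k, α k ∈ Set.Ioc (0 : ℝ) 2) (hα_first : α ⟨0, hn⟩ < 2)
    (ω : ℝ) (x : ℝ) (hx : x ∈ Set.Icc (0 : ℝ) 1) :
    (∃ X : Ω → ℂ, FBMSource.IsWienerIntegral P H B (FBMSource.greenExt α ω x) X) ∧
    (∀ X X' : Ω → ℂ, FBMSource.IsWienerIntegral P H B (FBMSource.greenExt α ω x) X →
      FBMSource.IsWienerIntegral P H B (FBMSource.greenExt α ω x) X' → X =ᵐ[P] X') ∧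
    (∀ X : Ω → ℂ, FBMSource.IsWienerIntegral P H B (FBMSource.greenExt α ω x) X →
      Integrable (fun ζ : ℝ ↦
        ‖FBMSource.fourierT (FBMSource.greenExt α ω x) ζ‖ ^ 2 / |ζ| ^ (2 * H - 1)) ∧
      ∫ ϖ, ‖X ϖ‖ ^ 2 ∂P = FBMSource.CH H ^ 2 *
        ∫ ζ : ℝ, ‖FBMSource.fourierT (FBMSource.greenExt α ω x) ζ‖ ^ 2 / |ζ| ^ (2 * H - 1)) ∧
    (H < 1 / 2 → FBMSource.MemH (1 / 2 - H) (FBMSource.greenExt α ω x)) ∧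
    (x < 1 → ¬ FBMSource.MemH 1 (FBMSource.greenExt α ω x)) := by
  obtain ⟨g, M, L, hg, hfg, hg0⟩ := FBMSource.exists_isClampLipschitz_green α ω x
  have h0 := FBMSource.green_zero_ne_zero hn hα_mem hα_first ω hx.1
  rw [← hg0] at h0
  have hi := hg.integrable_indicator
  have hi2 := hg.memLp_indicator
  rw [hfg]
  refine ⟨hg.exists_isWienerIntegral hB hH0 hH1, fun X X' hX hX' ↦ ?_, fun X hX ↦ ?_,
    fun _ ↦ hg.memH (by linarith), fun hx1 ↦
      FBMSource.not_memH_one_of_jump hg.lipschitz.continuous hi (h0 hx1)⟩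
  · exact (hX.isSpectralIntegral hH0 hH1 hi hi2).ae_eq hB hH0 hH1
      (hX'.isSpectralIntegral hH0 hH1 hi hi2)
  · exact (hX.isSpectralIntegral hH0 hH1 hi hi2).integral_norm_sq hB hH0 hH1
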